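/- Let $X_0, X_1, X_2, \ldots$ be independent and identically distributed real random variables on a common probability space, with mean zero and variance one. For $n \ge 1$ let $SC_n$ be the $n \times n$ symmetric circulant matrix with entries $\{X_j/\sqrt n\}_{j\ge 0}$, that is, the random real symmetric matrix $$(SC_n)_{i,j} = \frac{1}{\sqrt n}\, X_{\frac n2 - \left|\frac n2 - |i-j|\right|} = \frac{1}{\sqrt n}\, X_{\min(|i-j|,\, n-|i-j|)}, \qquad 1 \le i,j \le n,$$ and let $F_{SC_n}(x) = \frac1n \sum_{k=1}^n \mathbf 1(\lambda_k \le x)$, $x\in\mathbb R$, be its empirical spectral distribution, where $\lambda_1,\ldots,\lambda_n$ are the eigenvalues of $SC_n$ counted with multiplicity. Then, almost surely, $F_{SC_n}$ converges weakly, as $n\to\infty$, to the standard Gaussian distribution $N(0,1)$. -/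

import Mathlib

open MeasureTheory ProbabilityTheory Filter Topology

noncomputable section

/-- The position in the input sequence of the `(i, j)`-th entry of the `n × n` symmetric
circulant matrix, namely `n / 2 - |n / 2 - |i - j|| = min |i - j| (n - |i - j|)`. -/
def symCircIndex (n : ℕ) (i j : Fin n) : ℕ :=
  min ((i : ℤ) - (j : ℤ)).natAbs (n - ((i : ℤ) - (j : ℤ)).natAbs)

theorem symCircIndex_cast (n : ℕ) (i j : Fin n) :
    (symCircIndex n i j : ℝ) = (n : ℝ) / 2 - |(n : ℝ) / 2 - (|(i : ℝ) - (j : ℝ)|)| := by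
  have hd : ((i : ℤ) - (j : ℤ)).natAbs ≤ n := by omega
  have hc : (((i : ℤ) - (j : ℤ)).natAbs : ℝ) = |(i : ℝ) - (j : ℝ)| := by
    rw [Nat.cast_natAbs]; push_cast; rfl
  rw [symCircIndex, ← hc]
  push_cast [Nat.cast_sub hd]
  rcases le_total (((i : ℤ) - (j : ℤ)).natAbs : ℝ) ((n : ℝ) / 2) with h | h
  · rw [abs_of_nonneg (by linarith), min_eq_left (by linarith)]; ring
  · rw [abs_of_nonpos (by linarith), min_eq_right (by linarith)]; ring

/-- The `n × n` symmetric circulant matrix with input sequence `x`. -/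
def symCirculant (n : ℕ) (x : ℕ → ℝ) : Matrix (Fin n) (Fin n) ℝ :=
  Matrix.of fun i j => x (symCircIndex n i j)

theorem symCirculant_isHermitian (n : ℕ) (x : ℕ → ℝ) : (symCirculant n x).IsHermitian := by
  ext i j
  have h : symCircIndex n j i = symCircIndex n i j := by
    unfold symCircIndex
    rw [← Int.natAbs_neg, neg_sub]
  simp [symCirculant, h]

/-- The empirical spectral distribution of a real symmetric `n × n` matrix, `n ≥ 1`: the
probability measure on `ℝ` putting mass `1 / n` at each eigenvalue, with multiplicity. -/
def esd {n : ℕ} [NeZero n] (A : Matrix (Fin n) (Fin n) ℝ) (hA : A.IsHermitian) :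
    ProbabilityMeasure ℝ :=
  ⟨(n : ENNReal)⁻¹ • ∑ k : Fin n, Measure.dirac (hA.eigenvalues k), ⟨by
    simp [ENNReal.inv_mul_cancel (Nat.cast_ne_zero.mpr (NeZero.ne n))
      (ENNReal.natCast_ne_top n)]⟩⟩

/-- The distribution function of `esd` is `x ↦ (1 / n) * #{k | λₖ ≤ x}`. -/
theorem cdf_esd {n : ℕ} [NeZero n] {A : Matrix (Fin n) (Fin n) ℝ} (hA : A.IsHermitian) (x : ℝ) :
    cdf (esd A hA : Measure ℝ) x
      = (1 / (n : ℝ)) * ∑ k : Fin n, if hA.eigenvalues k ≤ x then (1 : ℝ) else 0 := by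
  rw [cdf_eq_real, Measure.real]
  simp only [esd, ProbabilityMeasure.coe_mk, Measure.smul_apply, Measure.finsetSum_apply,
    Measure.dirac_apply' _ measurableSet_Iic, Set.indicator_apply, Set.mem_Iic, smul_eq_mul,
    ENNReal.toReal_mul, ENNReal.toReal_inv, ENNReal.toReal_natCast, one_div, Pi.one_apply]
  congr 1
  rw [ENNReal.toReal_sum (by intro k _; split_ifs <;> simp)]
  refine Finset.sum_congr rfl fun k _ => ?_
  split_ifs <;> simp

/-- The standard Gaussian distribution on `ℝ`. -/
def stdGaussianLaw : ProbabilityMeasure ℝ := ⟨gaussianReal 0 1, inferInstance⟩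

end

/-! A symmetric circulant matrix is diagonalised by the characters of `ZMod N`, whatever its
entries, so its eigenvalues are explicit linear forms `circEig` in the inputs, with coefficients
`circWeight` bounded by 2. Weak convergence is therefore read off the empirical characteristic
function `circCF`, and three facts about it suffice.

Mean. By independence, the expectation of each summand is a product of characteristic functions of
`X 0` at points of size O(1/√N). Replacing every factor by its Gaussian counterpart leaves a
Gaussian whose variance is the squared length of the weight vector over `N`, which is within 2/N of
1 unless `2 * k = 0` (`norm_integral_circCF_sub_le`).

Concentration. For bounded inputs, Bessel's inequality on `ZMod N` makes the squared one-coordinate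
differences of the statistic sum to O(1/N). Efron-Stein, applied to the centred statistic and then
to its square, gives a fourth central moment O(1/N²), which is summable. Unbounded inputs are
truncated: `circCF` is continuous in mean square (`norm_circCF_sub_circCF_le`), and the strong law
controls the truncation error. Truncated inputs need no recentring, since concentration does not use
the mean.

All arguments at once. Rational arguments share one null set; an eventual Lipschitz bound extends
the limit to real arguments, and Lévy's theorem concludes. -/

noncomputable section

/-! ### Cosine characters on the cycle and Bessel's inequality -/

/-- The distance from `d` to `0` in the cycle `ZMod N`. -/
def cycleDist (N : ℕ) [NeZero N] (d : ZMod N) : Fin N :=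
  ⟨min d.val (N - d.val), (min_le_left _ _).trans_lt (ZMod.val_lt d)⟩

/-- The real part of the `k`-th standard character of `ZMod N`, that is `cos (2 π k d / N)`. -/
def cosChar (N : ℕ) [NeZero N] (k d : ZMod N) : ℝ := (ZMod.stdAddChar (k * d) : ℂ).re

/-- The `k`-th eigenvalue of the symmetric circulant matrix with input `x`. -/
def circEig (N : ℕ) [NeZero N] (x : Fin N → ℝ) (k : ZMod N) : ℝ :=
  ∑ d, x (cycleDist N d) * cosChar N k d

section Algebra

variable {N : ℕ} [NeZero N]

theorem cycleDist_neg (d : ZMod N) : cycleDist N (-d) = cycleDist N d := by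
  apply Fin.ext
  simp only [cycleDist, ZMod.neg_val]
  have := ZMod.val_lt d
  split_ifs with h
  · simp [h]
  · omega

theorem cycleDist_eq_iff (d e : ZMod N) : cycleDist N d = cycleDist N e ↔ d = e ∨ d = -e := by
  constructor
  · intro h
    have h' := congrArg Fin.val h
    simp only [cycleDist] at h'
    have hd := ZMod.val_lt d
    have he := ZMod.val_lt e
    by_cases h1 : d.val = e.val
    · exact Or.inl (ZMod.val_injective N h1)
    · right
      apply ZMod.val_injective N
      rw [ZMod.neg_val]
      split_ifs with h0
      · subst h0
        simp only [ZMod.val_zero] at *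
        omega
      · omega
  · rintro (rfl | rfl)
    · rfl
    · exact cycleDist_neg e

theorem cosChar_neg (k d : ZMod N) : cosChar N k (-d) = cosChar N k d := by
  simp [cosChar, mul_neg, AddChar.map_neg_eq_conj]

theorem abs_cosChar_le (k d : ZMod N) : |cosChar N k d| ≤ 1 :=
  (Complex.abs_re_le_norm _).trans (AddChar.norm_apply _ _).le

theorem cosChar_comm (k d : ZMod N) : cosChar N k d = cosChar N d k := by
  simp [cosChar, mul_comm]

theorem sum_stdAddChar_mul (k : ZMod N) :
    ∑ d : ZMod N, (ZMod.stdAddChar (k * d) : ℂ) = if k = 0 then (N : ℂ) else 0 := by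
  have := AddChar.sum_mulShift k (ZMod.isPrimitive_stdAddChar N)
  simp only [ZMod.card] at this
  simp_rw [mul_comm k, this]
  split_ifs <;> simp

theorem sum_cosChar (k : ZMod N) :
    ∑ d : ZMod N, cosChar N k d = if k = 0 then (N : ℝ) else 0 := by
  have := congrArg Complex.re (sum_stdAddChar_mul k)
  rw [Complex.re_sum] at this
  simp only [cosChar, this]
  split_ifs <;> simp

theorem cosChar_sq (k d : ZMod N) : cosChar N k d ^ 2 = (1 + cosChar N (2 * k) d) / 2 := by
  have h1 : (ZMod.stdAddChar (2 * k * d) : ℂ) = ZMod.stdAddChar (k * d) ^ 2 := by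
    rw [mul_assoc, two_mul, AddChar.map_add_eq_mul, sq]
  have h2 : ‖(ZMod.stdAddChar (k * d) : ℂ)‖ = 1 := AddChar.norm_apply _ _
  have h3 := Complex.sq_norm (ZMod.stdAddChar (k * d) : ℂ)
  rw [h2, Complex.normSq_apply] at h3
  simp only [cosChar, h1, sq, Complex.mul_re]
  linarith

/-- Parseval's identity on `ZMod N`. -/
theorem sum_norm_sq_sum_stdAddChar (u : ZMod N → ℝ) :
    ∑ d, ‖∑ k, (u k : ℂ) * ZMod.stdAddChar (k * d)‖ ^ 2 = N * ∑ k, u k ^ 2 := by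
  have key : ∀ d : ZMod N, ((‖∑ k, (u k : ℂ) * ZMod.stdAddChar (k * d)‖ ^ 2 : ℝ) : ℂ)
      = ∑ k, ∑ l, (u k : ℂ) * u l * ZMod.stdAddChar ((k - l) * d) := by
    intro d
    rw [← Complex.normSq_eq_norm_sq, ← Complex.mul_conj, map_sum, Finset.sum_mul_sum]
    refine Finset.sum_congr rfl fun k _ => Finset.sum_congr rfl fun l _ => ?_
    rw [sub_mul, sub_eq_add_neg, AddChar.map_add_eq_mul, AddChar.map_neg_eq_conj,
      map_mul (starRingEnd ℂ), Complex.conj_ofReal]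
    ring
  have : ((∑ d, ‖∑ k, (u k : ℂ) * ZMod.stdAddChar (k * d)‖ ^ 2 : ℝ) : ℂ)
      = ((N * ∑ k, u k ^ 2 : ℝ) : ℂ) := by
    rw [Complex.ofReal_sum]
    simp_rw [key]
    rw [Finset.sum_comm]
    simp_rw [Finset.sum_comm (s := (Finset.univ : Finset (ZMod N))) (t := Finset.univ)
      (f := fun d l => (u _ : ℂ) * u l * ZMod.stdAddChar ((_ - l) * d)), ← Finset.mul_sum,
      sum_stdAddChar_mul, sub_eq_zero]
    simp only [mul_ite, mul_zero, Finset.sum_ite_eq, Finset.mem_univ, if_true]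
    push_cast
    rw [Finset.mul_sum]
    exact Finset.sum_congr rfl fun k _ => by ring
  exact_mod_cast this

/-- Bessel's inequality for the cosine characters of `ZMod N`. -/
theorem sum_sq_sum_cosChar_le (u : ZMod N → ℝ) :
    ∑ d, (∑ k, u k * cosChar N k d) ^ 2 ≤ N * ∑ k, u k ^ 2 := by
  rw [← sum_norm_sq_sum_stdAddChar]
  refine Finset.sum_le_sum fun d _ => ?_
  have : ∑ k, u k * cosChar N k d = (∑ k, (u k : ℂ) * ZMod.stdAddChar (k * d)).re := by
    simp [cosChar, Complex.re_sum]
  rw [this, ← sq_abs]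
  exact pow_le_pow_left₀ (abs_nonneg _) (Complex.abs_re_le_norm _) 2

theorem card_cycleDist_fiber_le (j : Fin N) :
    (Finset.univ.filter fun d : ZMod N => cycleDist N d = j).card ≤ 2 := by
  by_cases h : ∃ e : ZMod N, cycleDist N e = j
  · obtain ⟨e, rfl⟩ := h
    refine (Finset.card_le_card (t := {e, -e}) fun d hd => ?_).trans Finset.card_le_two
    simpa using (cycleDist_eq_iff d e).1 (Finset.mem_filter.1 hd).2
  · push Not at h
    simp [Finset.filter_false_of_mem fun d _ => h d]

theorem sum_comp_cycleDist_le (y : Fin N → ℝ) (hy : ∀ j, 0 ≤ y j) :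
    ∑ d, y (cycleDist N d) ≤ 2 * ∑ j, y j := by
  rw [← Finset.sum_fiberwise Finset.univ (cycleDist N), Finset.mul_sum]
  refine Finset.sum_le_sum fun j _ => ?_
  rw [Finset.sum_congr rfl (g := fun _ => y j)
    fun d hd => by rw [(Finset.mem_filter.1 hd).2], Finset.sum_const, nsmul_eq_mul]
  exact mul_le_mul_of_nonneg_right (by exact_mod_cast card_cycleDist_fiber_le j) (hy j)

/-- Bessel's inequality with the inputs as coefficients; the 2 is the size of a fibre `{d, -d}`.
This is the source of mean-square continuity in the inputs. -/
theorem sum_circEig_sq_le (x : Fin N → ℝ) :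
    ∑ k, circEig N x k ^ 2 ≤ 2 * N * ∑ j, x j ^ 2 := by
  have h := sum_sq_sum_cosChar_le (fun d => x (cycleDist N d))
  simp_rw [cosChar_comm] at h
  calc ∑ k, circEig N x k ^ 2 ≤ N * ∑ d, x (cycleDist N d) ^ 2 := by
        convert! h using 4
    _ ≤ N * (2 * ∑ j, x j ^ 2) := by
        gcongr
        exact sum_comp_cycleDist_le (fun j => x j ^ 2) fun j => sq_nonneg _
    _ = _ := by ring

/-! ### Coefficients of the eigenvalues as linear forms -/

/-- The coefficient of `x j` in `circEig N x k`. -/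
def circWeight (N : ℕ) [NeZero N] (k : ZMod N) (j : Fin N) : ℝ :=
  ∑ d with cycleDist N d = j, cosChar N k d

theorem circEig_eq_sum_weight (x : Fin N → ℝ) (k : ZMod N) :
    circEig N x k = ∑ j, x j * circWeight N k j := by
  rw [circEig, ← Finset.sum_fiberwise Finset.univ (cycleDist N)]
  refine Finset.sum_congr rfl fun j _ => ?_
  rw [circWeight, Finset.mul_sum]
  exact Finset.sum_congr rfl fun d hd => by rw [(Finset.mem_filter.1 hd).2]

theorem abs_circWeight_le (k : ZMod N) (j : Fin N) : |circWeight N k j| ≤ 2 := by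
  refine (Finset.abs_sum_le_sum_abs _ _).trans ?_
  refine (Finset.sum_le_sum fun d _ => abs_cosChar_le k d).trans ?_
  rw [Finset.sum_const, nsmul_eq_mul, mul_one]
  exact_mod_cast card_cycleDist_fiber_le j

/-- The dual Bessel bound, by Cauchy-Schwarz on fibres of size at most 2. For bounded `u` it gives
O(N²), where bounding each weight by 2 gives only O(N³); concentration rests on this gain. -/
theorem sum_sq_sum_circWeight_le (u : ZMod N → ℝ) :
    ∑ j, (∑ k, u k * circWeight N k j) ^ 2 ≤ 2 * N * ∑ k, u k ^ 2 := by
  calc ∑ j, (∑ k, u k * circWeight N k j) ^ 2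
      = ∑ j, (∑ d with cycleDist N d = j, ∑ k, u k * cosChar N k d) ^ 2 := by
        refine Finset.sum_congr rfl fun j _ => ?_
        rw [Finset.sum_comm]
        simp only [circWeight, Finset.mul_sum]
    _ ≤ ∑ j, 2 * ∑ d with cycleDist N d = j, (∑ k, u k * cosChar N k d) ^ 2 := by
        refine Finset.sum_le_sum fun j _ => sq_sum_le_card_mul_sum_sq.trans ?_
        refine mul_le_mul_of_nonneg_right ?_ (Finset.sum_nonneg fun _ _ => sq_nonneg _)
        exact_mod_cast card_cycleDist_fiber_le j
    _ = 2 * ∑ d, (∑ k, u k * cosChar N k d) ^ 2 := by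
        rw [← Finset.mul_sum, Finset.sum_fiberwise]
    _ ≤ _ := by
        have := sum_sq_sum_cosChar_le u
        linarith

theorem card_two_mul_eq_zero_le : (Finset.univ.filter fun d : ZMod N => 2 * d = 0).card ≤ 2 := by
  by_cases h : ∃ e : ZMod N, e ≠ 0 ∧ 2 * e = 0
  · obtain ⟨e, he0, he⟩ := h
    refine (Finset.card_le_card (t := {0, e}) fun d hd => ?_).trans Finset.card_le_two
    have hval : ∀ a : ZMod N, 2 * a = 0 → a ≠ 0 → 2 * a.val = N := by
      intro a ha ha0
      have h1 : ((2 * a.val : ℕ) : ZMod N) = 0 := by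
        push_cast
        rw [ZMod.natCast_zmod_val, ha]
      rw [ZMod.natCast_eq_zero_iff] at h1
      obtain ⟨c, hc⟩ := h1
      have h2 := ZMod.val_lt a
      have h3 : a.val ≠ 0 := fun h => ha0 ((ZMod.val_eq_zero a).1 h)
      have h4 : c < 2 := by nlinarith
      interval_cases c <;> omega
    by_cases hd0 : d = 0
    · simp [hd0]
    · have h1 := hval d (Finset.mem_filter.1 hd).2 hd0
      have h2 := hval e he he0
      have : d = e := ZMod.val_injective N (by omega)
      simp [this]
  · push Not at h
    refine (Finset.card_le_card (t := {0}) fun d hd => ?_).trans (by simp)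
    have := (Finset.mem_filter.1 hd).2
    by_contra h0
    exact h d (by simpa using h0) this

/-- A generic fibre `{d, -d}` contributes weight `2 * cos`, but a self-inverse `d` (at most two of
them) only `cos`; the last sum corrects for those. -/
theorem sum_circWeight_sq (k : ZMod N) :
    ∑ j, circWeight N k j ^ 2
      = 2 * ∑ d, cosChar N k d ^ 2 - ∑ d with 2 * d = 0, cosChar N k d ^ 2 := by
  have hfib : ∀ d : ZMod N, circWeight N k (cycleDist N d)
      = 2 * cosChar N k d - if 2 * d = 0 then cosChar N k d else 0 := by
    intro d
    have : (Finset.univ.filter fun e : ZMod N => cycleDist N e = cycleDist N d) = {d, -d} := by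
      ext e
      simp [cycleDist_eq_iff]
    rw [circWeight, this]
    by_cases h : 2 * d = 0
    · have h' : -d = d := by
        rw [two_mul] at h
        exact neg_eq_of_add_eq_zero_left h
      simp [h, h']
      ring
    · have h' : d ≠ -d := fun h0 => h (by rw [two_mul]; nth_rw 2 [h0]; simp)
      rw [Finset.sum_pair h', cosChar_neg, if_neg h]
      ring
  calc ∑ j, circWeight N k j ^ 2
      = ∑ j, ∑ d with cycleDist N d = j, cosChar N k d * circWeight N k (cycleDist N d) := by
        refine Finset.sum_congr rfl fun j _ => ?_
        rw [sq]
        nth_rw 1 [circWeight]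
        rw [Finset.sum_mul]
        exact Finset.sum_congr rfl fun d hd => by rw [(Finset.mem_filter.1 hd).2]
    _ = ∑ d, cosChar N k d * circWeight N k (cycleDist N d) := Finset.sum_fiberwise _ _ _
    _ = _ := by
        rw [Finset.sum_filter, Finset.mul_sum, ← Finset.sum_sub_distrib]
        refine Finset.sum_congr rfl fun d _ => ?_
        rw [hfib]
        split_ifs <;> ring

/-- By the double-angle formula, twice the sum of squared cosines is `N` plus a full character sum
at `2 * k`, which vanishes unless `2 * k = 0`. -/
theorem abs_sum_circWeight_sq_sub_le (k : ZMod N) :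
    |∑ j, circWeight N k j ^ 2 - N| ≤ (if 2 * k = 0 then (N : ℝ) else 0) + 2 := by
  have h1 : 2 * ∑ d, cosChar N k d ^ 2 = N + if 2 * k = 0 then (N : ℝ) else 0 := by
    simp_rw [cosChar_sq]
    rw [← Finset.sum_div, Finset.sum_add_distrib, sum_cosChar]
    simp
    ring
  have h2 : ∑ d with 2 * d = 0, cosChar N k d ^ 2 ≤ 2 := by
    calc ∑ d with 2 * d = 0, cosChar N k d ^ 2 ≤ ∑ d : ZMod N with 2 * d = 0, (1 : ℝ) := by
          refine Finset.sum_le_sum fun d _ => ?_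
          rw [← sq_abs]
          exact pow_le_one₀ (abs_nonneg _) (abs_cosChar_le k d)
      _ ≤ 2 := by
          rw [Finset.sum_const, nsmul_eq_mul, mul_one]
          exact_mod_cast card_two_mul_eq_zero_le
  have h3 : 0 ≤ ∑ d with 2 * d = 0, cosChar N k d ^ 2 := Finset.sum_nonneg fun _ _ => sq_nonneg _
  have h4 : (0 : ℝ) ≤ if 2 * k = 0 then (N : ℝ) else 0 := by split_ifs <;> simp
  rw [sum_circWeight_sq, h1, abs_le]
  constructor <;> linarith

/-- On average over the eigenvalues, the coefficient vectors have squared length close to `N`. -/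
theorem sum_abs_sum_circWeight_sq_sub_le :
    ∑ k : ZMod N, |∑ j, circWeight N k j ^ 2 - N| ≤ 4 * N := by
  refine (Finset.sum_le_sum fun k _ => abs_sum_circWeight_sq_sub_le k).trans ?_
  rw [Finset.sum_add_distrib, ← Finset.sum_filter, Finset.sum_const, Finset.sum_const]
  simp only [nsmul_eq_mul, Finset.card_univ, ZMod.card]
  have : ((Finset.univ.filter fun d : ZMod N => 2 * d = 0).card : ℝ) ≤ 2 := by
    exact_mod_cast card_two_mul_eq_zero_le
  have hN : (0 : ℝ) ≤ N := Nat.cast_nonneg N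
  nlinarith

theorem circEig_sub (x y : Fin N → ℝ) (k : ZMod N) :
    circEig N (fun j => x j - y j) k = circEig N x k - circEig N y k := by
  simp [circEig, sub_mul, Finset.sum_sub_distrib]

theorem circEig_div (x : Fin N → ℝ) (c : ℝ) (k : ZMod N) :
    circEig N (fun j => x j / c) k = circEig N x k / c := by
  simp only [circEig, Finset.sum_div]
  exact Finset.sum_congr rfl fun d _ => by ring

/-! ### Diagonalisation by the Fourier matrix -/

/-- The Fourier matrix of `ZMod N`. -/
def fourierMatrix (N : ℕ) [NeZero N] : Matrix (ZMod N) (ZMod N) ℂ :=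
  Matrix.of fun d k => ZMod.stdAddChar (k * d)

open Matrix in
theorem fourierMatrix_mul_conjTranspose :
    fourierMatrix N * (fourierMatrix N)ᴴ = (N : ℂ) • (1 : Matrix (ZMod N) (ZMod N) ℂ) := by
  ext d e
  simp only [fourierMatrix, Matrix.mul_apply, Matrix.of_apply, Matrix.conjTranspose_apply,
    RCLike.star_def, Matrix.smul_apply, Matrix.one_apply]
  have : ∀ k : ZMod N, (ZMod.stdAddChar (k * d) : ℂ) * (starRingEnd ℂ) (ZMod.stdAddChar (k * e))
      = ZMod.stdAddChar ((d - e) * k) := by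
    intro k
    rw [← AddChar.map_neg_eq_conj, ← AddChar.map_add_eq_mul]
    congr 1
    ring
  simp_rw [this, sum_stdAddChar_mul, sub_eq_zero]
  simp

/-- The inputs are even in `d`, so the sine parts cancel and the cosine sum is a genuine Fourier
transform. -/
theorem circEig_cast (x : Fin N → ℝ) (k : ZMod N) :
    (circEig N x k : ℂ) = ∑ d, (x (cycleDist N d) : ℂ) * ZMod.stdAddChar (-(k * d)) := by
  have hconj : ∑ d, (x (cycleDist N d) : ℂ) * ZMod.stdAddChar (k * d)
      = ∑ d, (x (cycleDist N d) : ℂ) * ZMod.stdAddChar (-(k * d)) := by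
    refine Fintype.sum_equiv (Equiv.neg _) _ _ fun d => ?_
    simp [cycleDist_neg]
  have h2 : (circEig N x k : ℂ) = (∑ d, (x (cycleDist N d) : ℂ) * ZMod.stdAddChar (k * d)
      + ∑ d, (x (cycleDist N d) : ℂ) * ZMod.stdAddChar (-(k * d))) / 2 := by
    rw [← Finset.sum_add_distrib, Finset.sum_div, circEig, Complex.ofReal_sum]
    refine Finset.sum_congr rfl fun d _ => ?_
    rw [cosChar, Complex.ofReal_mul, Complex.re_eq_add_conj, ← AddChar.map_neg_eq_conj]
    ring
  rw [h2, hconj]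
  ring

open Matrix in
theorem circulant_mul_fourierMatrix (x : Fin N → ℝ) :
    (Matrix.of fun i j : ZMod N => (x (cycleDist N (i - j)) : ℂ)) * fourierMatrix N
      = fourierMatrix N * Matrix.diagonal fun k => (circEig N x k : ℂ) := by
  ext i k
  rw [Matrix.mul_diagonal, Matrix.mul_apply]
  simp only [fourierMatrix, Matrix.of_apply]
  rw [circEig_cast, Finset.mul_sum]
  refine Fintype.sum_equiv (Equiv.subLeft i) _ _ fun j => ?_
  simp only [Equiv.subLeft_apply]
  have : (ZMod.stdAddChar (k * j) : ℂ)
      = ZMod.stdAddChar (k * i) * ZMod.stdAddChar (-(k * (i - j))) := by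
    rw [← AddChar.map_add_eq_mul]
    congr 1
    ring
  rw [this]
  ring

open Matrix in
-- The characteristic polynomial records the eigenvalues with multiplicity and can be compared after
-- passing to ℂ, where the Fourier matrix lives.
theorem charpoly_circulant (x : Fin N → ℝ) :
    (Matrix.of fun i j : ZMod N => x (cycleDist N (i - j))).charpoly
      = ∏ k, (Polynomial.X - Polynomial.C (circEig N x k)) := by
  apply Polynomial.map_injective Complex.ofRealHom Complex.ofReal_injective
  rw [← Matrix.charpoly_map, Polynomial.map_prod]
  simp only [Polynomial.map_sub, Polynomial.map_X, Polynomial.map_C]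
  have hN : (N : ℂ) ≠ 0 := Nat.cast_ne_zero.2 (NeZero.ne N)
  set V := fourierMatrix N
  set W := (N : ℂ)⁻¹ • Vᴴ
  have hVW : V * W = 1 := by
    rw [Matrix.mul_smul, fourierMatrix_mul_conjTranspose, smul_smul, inv_mul_cancel₀ hN, one_smul]
  have hWV : W * V = 1 := mul_eq_one_comm.1 hVW
  have hA : (Matrix.of fun i j : ZMod N => x (cycleDist N (i - j))).map Complex.ofRealHom
      = V * (Matrix.diagonal (fun k => (circEig N x k : ℂ)) * W) := by
    rw [← Matrix.mul_assoc, ← circulant_mul_fourierMatrix, Matrix.mul_assoc, hVW, Matrix.mul_one]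
    ext i j
    simp
  rw [hA, Matrix.charpoly_mul_comm, Matrix.mul_assoc, hWV, Matrix.mul_one,
    Matrix.charpoly_diagonal]
  rfl

end Algebra

theorem symCircIndex_eq_cycleDist (n : ℕ) (i j : Fin (n + 1)) :
    symCircIndex (n + 1) i j = cycleDist (n + 1) ((i - j : Fin (n + 1)) : ZMod (n + 1)) := by
  have h : ZMod.val (n := n + 1) ((i - j : Fin (n + 1)) : ZMod (n + 1)) = (i - j : Fin (n + 1)).val :=
    rfl
  simp only [cycleDist, symCircIndex]
  rw [h, Fin.val_sub]
  have hi := i.isLt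
  have hj := j.isLt
  rcases le_or_gt j.val i.val with hij | hij
  · have : (n + 1 - j.val + i.val) % (n + 1) = i.val - j.val := by
      rw [show n + 1 - j.val + i.val = (i.val - j.val) + (n + 1) by omega, Nat.add_mod_right,
        Nat.mod_eq_of_lt (by omega)]
    rw [this]
    omega
  · rw [Nat.mod_eq_of_lt (by omega)]
    omega

theorem charpoly_symCirculant (n : ℕ) (x : ℕ → ℝ) :
    (symCirculant (n + 1) x).charpoly
      = ∏ k, (Polynomial.X - Polynomial.C (circEig (n + 1) (fun j => x j) k)) := by
  rw [← charpoly_circulant]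
  have : symCirculant (n + 1) x = (Matrix.of fun i j : Fin (n + 1) =>
      x (cycleDist (n + 1) ((i - j : Fin (n + 1)) : ZMod (n + 1)))) := by
    ext i j
    simp [symCirculant, symCircIndex_eq_cycleDist]
  rw [this]
  rfl

/-- The two families agree only as multisets of roots, not index by index, so the comparison is made
through symmetric sums. -/
theorem sum_eigenvalues_symCirculant {E : Type*} [AddCommMonoid E] (n : ℕ) (x : ℕ → ℝ)
    (g : ℝ → E) :
    ∑ i, g ((symCirculant_isHermitian (n + 1) x).eigenvalues i)
      = ∑ k, g (circEig (n + 1) (fun j => x j) k) := by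
  have h := (symCirculant_isHermitian (n + 1) x).roots_charpoly_eq_eigenvalues
  rw [charpoly_symCirculant] at h
  rw [show ∏ k, (Polynomial.X - Polynomial.C (circEig (n + 1) (fun j => x j) k))
    = (Multiset.map (fun a => Polynomial.X - Polynomial.C a)
      (Multiset.map (circEig (n + 1) (fun j => x j)) Finset.univ.val)).prod by
        rw [Multiset.map_map]; rfl, Polynomial.roots_multiset_prod_X_sub_C] at h
  have h2 := congrArg (fun s => (Multiset.map g s).sum) h
  simp only [Multiset.map_map] at h2
  exact h2.symm

theorem integrable_of_measurable_of_abs_le {Ω : Type*} [MeasurableSpace Ω] {P : Measure Ω}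
    [IsFiniteMeasure P] {F : Ω → ℝ} (hF : Measurable F) {B : ℝ} (hB : ∀ ω, |F ω| ≤ B) :
    Integrable F P :=
  Integrable.of_bound hF.aestronglyMeasurable B (ae_of_all _ hB)

theorem measurePreserving_fst_comp {ι α : Type*} [Fintype ι] [MeasurableSpace α] (ν : Measure α)
    [IsProbabilityMeasure ν] :
    MeasurePreserving (fun (z : ι → α × α) i => (z i).1) (Measure.pi fun _ : ι => ν.prod ν)
      (Measure.pi fun _ : ι => ν) :=
  measurePreserving_pi _ _ (f := fun _ => Prod.fst) fun _ => measurePreserving_fst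

/-! ### The Efron-Stein inequality and a fourth moment bound -/

section EfronStein

variable {ι α : Type*} [DecidableEq ι]

/-- Exchange the two components of the coordinates in `S`. -/
def swapOn (S : Finset ι) (z : ι → α × α) : ι → α × α :=
  fun i => if i ∈ S then (z i).swap else z i

theorem swapOn_empty (z : ι → α × α) : swapOn ∅ z = z := by
  funext i
  simp [swapOn]

theorem swapOn_insert {j : ι} {S : Finset ι} (hj : j ∉ S) (z : ι → α × α) :
    swapOn (insert j S) z = swapOn S (swapOn {j} z) := by
  funext i
  by_cases h : i = j
  · subst h
    simp [swapOn, hj]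
  · simp [swapOn, h]

theorem swapOn_comm (S T : Finset ι) (z : ι → α × α) :
    swapOn S (swapOn T z) = swapOn T (swapOn S z) := by
  funext i
  simp only [swapOn]
  split_ifs <;> rfl

theorem swapOn_swapOn (S : Finset ι) (z : ι → α × α) : swapOn S (swapOn S z) = z := by
  funext i
  simp only [swapOn]
  split_ifs <;> simp

theorem fst_swapOn_singleton (j : ι) (z : ι → α × α) :
    (fun i => (swapOn {j} z i).1) = Function.update (fun i => (z i).1) j (z j).2 := by
  funext i
  by_cases h : i = j
  · subst h
    simp [swapOn]
  · simp [swapOn, h]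

variable [Fintype ι] [MeasurableSpace α] (ν : Measure α) [IsProbabilityMeasure ν]

theorem measurePreserving_swapOn (S : Finset ι) :
    MeasurePreserving (swapOn (α := α) S) (Measure.pi fun _ : ι => ν.prod ν)
      (Measure.pi fun _ : ι => ν.prod ν) := by
  refine measurePreserving_pi _ _ (f := fun i (p : α × α) => if i ∈ S then p.swap else p) fun i => ?_
  by_cases h : i ∈ S
  · simp only [h, if_true]
    exact Measure.measurePreserving_swap
  · simp only [h, if_false]
    exact MeasurePreserving.id _

theorem integral_comp_swapOn (S : Finset ι) {F : (ι → α × α) → ℝ} (hF : Measurable F) :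
    ∫ z, F (swapOn S z) ∂(Measure.pi fun _ : ι => ν.prod ν)
      = ∫ z, F z ∂(Measure.pi fun _ : ι => ν.prod ν) := by
  have h := measurePreserving_swapOn ν S
  conv_rhs => rw [← h.map_eq]
  rw [integral_map h.measurable.aemeasurable hF.aestronglyMeasurable]

/-- One step of the telescoping argument behind the Efron-Stein inequality. -/
theorem integral_mul_swapOn_sub_swapOn_insert_le {F : (ι → α × α) → ℝ} (hF : Measurable F)
    {B : ℝ} (hB : ∀ z, |F z| ≤ B) {S : Finset ι} {j : ι} (hj : j ∉ S) :
    ∫ z, F z * (F (swapOn S z) - F (swapOn (insert j S) z))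
        ∂(Measure.pi fun _ : ι => ν.prod ν)
      ≤ (1 / 2) * ∫ z, (F z - F (swapOn {j} z)) ^ 2 ∂(Measure.pi fun _ : ι => ν.prod ν) := by
  set P := Measure.pi fun _ : ι => ν.prod ν
  have hS : ∀ S : Finset ι, Measurable fun z => F (swapOn S z) := fun S =>
    hF.comp (measurePreserving_swapOn ν S).measurable
  set D : (ι → α × α) → ℝ := fun z => F z - F (swapOn {j} z)
  have hD : Measurable D := hF.sub (hS _)
  have hDS : Measurable fun z => D (swapOn S z) :=
    hD.comp (measurePreserving_swapOn ν S).measurable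
  have hDB : ∀ z, |D z| ≤ 2 * B := fun z => (abs_sub _ _).trans (by linarith [hB z, hB (swapOn {j} z)])
  have hB0 : ∀ z : ι → α × α, 0 ≤ B := fun z => (abs_nonneg _).trans (hB z)
  have hmul : ∀ {G H : (ι → α × α) → ℝ}, Measurable G → Measurable H → (∀ z, |G z| ≤ 2 * B) →
      (∀ z, |H z| ≤ 2 * B) → Integrable (fun z => G z * H z) P := by
    intro G H hG hH hGB hHB
    refine integrable_of_measurable_of_abs_le (hG.mul hH) (B := 2 * B * (2 * B)) fun z => ?_
    rw [abs_mul]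
    have := hB0 z
    exact mul_le_mul (hGB z) (hHB z) (abs_nonneg _) (by linarith)
  have hF2 : ∀ z, |F z| ≤ 2 * B := fun z => (hB z).trans (by linarith [hB0 z])
  have hrew : ∀ z, F (swapOn S z) - F (swapOn (insert j S) z) = D (swapOn S z) := by
    intro z
    simp only [D]
    rw [swapOn_insert hj, swapOn_comm]
  -- Exchanging coordinate `j` with its copy preserves the measure and changes the sign of `D`, also
  -- after `swapOn S`. Averaging the two forms replaces `F` by `D / 2`.
  have hflip : ∫ z, F z * D (swapOn S z) ∂P = - ∫ z, F (swapOn {j} z) * D (swapOn S z) ∂P := by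
    rw [← integral_comp_swapOn ν {j} (F := fun z => F z * D (swapOn S z)) (hF.mul hDS),
      ← integral_neg]
    refine integral_congr_ae (ae_of_all _ fun z => ?_)
    simp only [D]
    rw [swapOn_comm S {j} z, swapOn_swapOn]
    ring
  have hsum : ∫ z, F z * D (swapOn S z) ∂P = (1 / 2) * ∫ z, D z * D (swapOn S z) ∂P := by
    have : ∫ z, D z * D (swapOn S z) ∂P
        = ∫ z, F z * D (swapOn S z) ∂P - ∫ z, F (swapOn {j} z) * D (swapOn S z) ∂P := by
      rw [← integral_sub (hmul hF hDS hF2 fun z => hDB _)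
        (hmul (hS _) hDS (fun z => hF2 _) fun z => hDB _)]
      refine integral_congr_ae (ae_of_all _ fun z => ?_)
      simp only [D]
      ring
    rw [this]
    linarith
  simp_rw [hrew]
  rw [hsum]
  refine mul_le_mul_of_nonneg_left ?_ (by norm_num)
  have hint1 : Integrable (fun z => D z ^ 2) P := by
    simpa only [sq] using hmul hD hD hDB hDB
  have hint2 : Integrable (fun z => D (swapOn S z) ^ 2) P := by
    simpa only [sq] using hmul hDS hDS (fun z => hDB _) fun z => hDB _
  calc ∫ z, D z * D (swapOn S z) ∂P
      ≤ ∫ z, (1 / 2) * (D z ^ 2 + D (swapOn S z) ^ 2) ∂P := by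
        refine integral_mono (hmul hD hDS hDB fun z => hDB _) ((hint1.add hint2).const_mul _)
          fun z => ?_
        simp only
        nlinarith [sq_nonneg (D z - D (swapOn S z))]
    _ = ∫ z, D z ^ 2 ∂P := by
        rw [integral_const_mul, integral_add hint1 hint2,
          integral_comp_swapOn ν S (F := fun z => D z ^ 2) (hD.pow_const 2)]
        ring

/-- Telescoping over the coordinates of `S`, swapped one at a time. For the full set, the left side
becomes a variance when `F` depends only on the first components. -/
theorem integral_mul_sub_swapOn_le {F : (ι → α × α) → ℝ} (hF : Measurable F)
    {B : ℝ} (hB : ∀ z, |F z| ≤ B) (S : Finset ι) :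
    ∫ z, F z * (F z - F (swapOn S z)) ∂(Measure.pi fun _ : ι => ν.prod ν)
      ≤ (1 / 2) * ∑ j ∈ S, ∫ z, (F z - F (swapOn {j} z)) ^ 2
        ∂(Measure.pi fun _ : ι => ν.prod ν) := by
  induction S using Finset.induction_on with
  | empty => simp [swapOn_empty]
  | insert j S hj ih =>
    have hS : ∀ S : Finset ι, Measurable fun z => F (swapOn S z) := fun S =>
      hF.comp (measurePreserving_swapOn ν S).measurable
    have hint : ∀ S T : Finset ι, Integrable (fun z => F z * (F (swapOn S z) - F (swapOn T z)))
        (Measure.pi fun _ : ι => ν.prod ν) := by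
      intro S T
      refine integrable_of_measurable_of_abs_le (hF.mul ((hS S).sub (hS T))) (B := B * (B + B))
        fun z => ?_
      rw [abs_mul]
      exact mul_le_mul (hB z) ((abs_sub _ _).trans (add_le_add (hB _) (hB _))) (abs_nonneg _)
        ((abs_nonneg _).trans (hB z))
    have hsplit : ∫ z, F z * (F z - F (swapOn (insert j S) z)) ∂(Measure.pi fun _ : ι => ν.prod ν)
        = ∫ z, F z * (F z - F (swapOn S z)) ∂(Measure.pi fun _ : ι => ν.prod ν)
          + ∫ z, F z * (F (swapOn S z) - F (swapOn (insert j S) z))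
            ∂(Measure.pi fun _ : ι => ν.prod ν) := by
      have h1 := hint ∅ S
      simp only [swapOn_empty] at h1
      rw [← integral_add h1 (hint S (insert j S))]
      refine integral_congr_ae (ae_of_all _ fun z => ?_)
      simp only
      ring
    rw [hsplit, Finset.sum_insert hj, mul_add]
    have := integral_mul_swapOn_sub_swapOn_insert_le ν hF hB hj
    linarith

/-- The **Efron-Stein inequality** for bounded functions of i.i.d. variables. -/
theorem integral_sq_sub_sq_integral_le {f : (ι → α) → ℝ} (hf : Measurable f) {B : ℝ}
    (hB : ∀ x, |f x| ≤ B) :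
    ∫ x, f x ^ 2 ∂(Measure.pi fun _ : ι => ν) - (∫ x, f x ∂(Measure.pi fun _ : ι => ν)) ^ 2
      ≤ (1 / 2) * ∑ j, ∫ z, (f (fun i => (z i).1)
        - f (Function.update (fun i => (z i).1) j (z j).2)) ^ 2
          ∂(Measure.pi fun _ : ι => ν.prod ν) := by
  have hfst := measurePreserving_fst_comp (ι := ι) ν
  set F : (ι → α × α) → ℝ := fun z => f (fun i => (z i).1)
  have hF : Measurable F := hf.comp hfst.measurable
  have key := integral_mul_sub_swapOn_le ν hF (fun z => hB _) Finset.univ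
  have hj : ∀ j z, F (swapOn {j} z) = f (Function.update (fun i => (z i).1) j (z j).2) :=
    fun j z => congrArg f (fst_swapOn_singleton j z)
  simp only [hj] at key
  refine le_trans (le_of_eq ?_) key
  have hprod := measurePreserving_arrowProdEquivProdArrow α α ι (fun _ => ν) (fun _ => ν)
  -- Swapping every coordinate yields an independent copy, so the integral of the product factors.
  have hcross : ∫ z, F z * F (swapOn Finset.univ z) ∂(Measure.pi fun _ : ι => ν.prod ν)
      = (∫ x, f x ∂(Measure.pi fun _ : ι => ν)) ^ 2 := by
    rw [sq, ← integral_prod_mul, ← hprod.map_eq, integral_map hprod.measurable.aemeasurable]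
    · refine integral_congr_ae (ae_of_all _ fun z => ?_)
      simp [F, swapOn, MeasurableEquiv.arrowProdEquivProdArrow, Equiv.arrowProdEquivProdArrow]
    · exact ((hf.comp measurable_fst).mul (hf.comp measurable_snd)).aestronglyMeasurable
  have hsq : ∫ z, F z ^ 2 ∂(Measure.pi fun _ : ι => ν.prod ν)
      = ∫ x, f x ^ 2 ∂(Measure.pi fun _ : ι => ν) := by
    rw [← hfst.map_eq, integral_map hfst.measurable.aemeasurable
      (hf.pow_const 2).aestronglyMeasurable]
  rw [← hsq, ← hcross, ← integral_sub]
  · refine integral_congr_ae (ae_of_all _ fun z => ?_)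
    simp only
    ring
  · refine integrable_of_measurable_of_abs_le (hF.pow_const 2) (B := B ^ 2) fun z => ?_
    rw [abs_pow]
    exact pow_le_pow_left₀ (abs_nonneg _) (hB _) 2
  · refine integrable_of_measurable_of_abs_le
      (hF.mul (hF.comp (measurePreserving_swapOn ν _).measurable)) (B := B * B) fun z => ?_
    simp only [abs_mul]
    exact mul_le_mul (hB _) (hB _) (abs_nonneg _) ((abs_nonneg _).trans (hB (fun i => (z i).1)))

/-- A fourth moment bound for functions of i.i.d. variables whose squared one-coordinate
differences have a uniformly bounded sum. -/
theorem integral_sub_integral_pow_four_le {f : (ι → α) → ℝ} (hf : Measurable f) {B : ℝ}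
    (hB : ∀ x, |f x| ≤ B) {c : ℝ}
    (hc : ∀ x y : ι → α, ∑ j, (f x - f (Function.update x j (y j))) ^ 2 ≤ c) :
    ∫ x, (f x - ∫ y, f y ∂(Measure.pi fun _ : ι => ν)) ^ 4 ∂(Measure.pi fun _ : ι => ν)
      ≤ 2 * c ^ 2 := by
  set Q := Measure.pi fun _ : ι => ν
  set P := Measure.pi fun _ : ι => ν.prod ν
  set m := ∫ y, f y ∂Q
  set g : (ι → α) → ℝ := fun x => f x - m
  have hfst : MeasurePreserving (fun (z : ι → α × α) i => (z i).1) P Q :=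
    measurePreserving_fst_comp (ι := ι) ν
  have hg : Measurable g := hf.sub_const m
  set C := B + |m|
  have hgB : ∀ x, |g x| ≤ C := fun x => (abs_sub _ _).trans (by linarith [hB x])
  have hgc : ∀ x y : ι → α, ∑ j, (g x - g (Function.update x j (y j))) ^ 2 ≤ c := by
    intro x y
    simpa [g] using hc x y
  have hupd : ∀ j, Measurable fun z : ι → α × α =>
      Function.update (fun i => (z i).1) j (z j).2 := by
    intro j
    have : (fun z : ι → α × α => Function.update (fun i => (z i).1) j (z j).2)
        = fun z => fun i => (swapOn {j} z i).1 := by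
      funext z
      rw [fst_swapOn_singleton]
    rw [this]
    exact hfst.measurable.comp (measurePreserving_swapOn ν {j}).measurable
  set G : (ι → α × α) → ℝ := fun z => g (fun i => (z i).1)
  set H : ι → (ι → α × α) → ℝ := fun j z => g (Function.update (fun i => (z i).1) j (z j).2)
  have hG : Measurable G := hg.comp hfst.measurable
  have hH : ∀ j, Measurable (H j) := fun j => hg.comp (hupd j)
  have hGH : ∀ j z, G (swapOn {j} z) = H j z := fun j z =>
    congrArg g (fst_swapOn_singleton j z)
  have hHG : ∀ j z, H j (swapOn {j} z) = G z := fun j z => by rw [← hGH, swapOn_swapOn]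
  have hpos : 0 ≤ C ^ 2 := sq_nonneg _
  have hD : ∀ j z, (G z - H j z) ^ 2 ≤ c := fun j z =>
    (Finset.single_le_sum (f := fun j => (G z - H j z) ^ 2) (fun _ _ => sq_nonneg _)
      (Finset.mem_univ j)).trans (hgc (fun i => (z i).1) fun i => (z i).2)
  have hGsq : ∀ z, G z ^ 2 ≤ C ^ 2 := fun z => by
    rw [← sq_abs]
    exact pow_le_pow_left₀ (abs_nonneg _) (hgB _) 2
  have hHsq : ∀ j z, H j z ^ 2 ≤ C ^ 2 := fun j z => by
    rw [← sq_abs]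
    exact pow_le_pow_left₀ (abs_nonneg _) (hgB _) 2
  have hintD : ∀ j, Integrable (fun z => (G z - H j z) ^ 2) P := fun j =>
    integrable_of_measurable_of_abs_le ((hG.sub (hH j)).pow_const 2) (B := c) fun z => by
      rw [abs_of_nonneg (sq_nonneg _)]
      exact hD j z
  have hintDG : ∀ j, Integrable (fun z => (G z - H j z) ^ 2 * G z ^ 2) P := fun j =>
    integrable_of_measurable_of_abs_le (((hG.sub (hH j)).pow_const 2).mul (hG.pow_const 2))
      (B := c * C ^ 2) fun z => by
      rw [abs_of_nonneg (mul_nonneg (sq_nonneg _) (sq_nonneg _))]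
      exact mul_le_mul (hD j z) (hGsq z) (sq_nonneg _) ((sq_nonneg _).trans (hD j z))
  have hintDH : ∀ j, Integrable (fun z => (G z - H j z) ^ 2 * H j z ^ 2) P := fun j =>
    integrable_of_measurable_of_abs_le (((hG.sub (hH j)).pow_const 2).mul ((hH j).pow_const 2))
      (B := c * C ^ 2) fun z => by
      rw [abs_of_nonneg (mul_nonneg (sq_nonneg _) (sq_nonneg _))]
      exact mul_le_mul (hD j z) (hHsq j z) (sq_nonneg _) ((sq_nonneg _).trans (hD j z))
  have hintG : Integrable (fun z => G z ^ 2) P :=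
    integrable_of_measurable_of_abs_le (hG.pow_const 2) (B := C ^ 2) fun z => by
      rw [abs_of_nonneg (sq_nonneg _)]
      exact hGsq z
  have hGQ : ∫ z, G z ^ 2 ∂P = ∫ x, g x ^ 2 ∂Q := by
    rw [← hfst.map_eq, integral_map hfst.measurable.aemeasurable
      (hg.pow_const 2).aestronglyMeasurable]
  have hmean : ∫ x, g x ∂Q = 0 := by
    simp only [g]
    rw [integral_sub (integrable_of_measurable_of_abs_le hf hB) (integrable_const _)]
    simp [m]
  have hvar : ∫ x, g x ^ 2 ∂Q ≤ (1 / 2) * c := by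
    have h1 := integral_sq_sub_sq_integral_le ν hg hgB
    rw [hmean] at h1
    have h2 : ∑ j, ∫ z, (G z - H j z) ^ 2 ∂P ≤ c := by
      rw [← integral_finsetSum _ fun j _ => hintD j]
      calc ∫ z, ∑ j, (G z - H j z) ^ 2 ∂P ≤ ∫ z, c ∂P :=
            integral_mono (integrable_finsetSum _ fun j _ => hintD j) (integrable_const _)
              fun z => hgc (fun i => (z i).1) fun i => (z i).2
        _ = c := by simp
    simp only [G, H] at h2
    linarith
  have hvar0 : 0 ≤ ∫ x, g x ^ 2 ∂Q := integral_nonneg fun _ => sq_nonneg _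
  have hflip : ∀ j, ∫ z, (G z - H j z) ^ 2 * H j z ^ 2 ∂P
      = ∫ z, (G z - H j z) ^ 2 * G z ^ 2 ∂P := by
    intro j
    have := integral_comp_swapOn ν {j} (F := fun z => (G z - H j z) ^ 2 * G z ^ 2)
      (((hG.sub (hH j)).pow_const 2).mul (hG.pow_const 2))
    rw [← this]
    refine integral_congr_ae (ae_of_all _ fun z => ?_)
    simp only [hGH, hHG]
    ring
  -- Efron-Stein for `g ^ 2`, with `(a² - b²)² ≤ 2 (a - b)² (a² + b²)`; the swap symmetry `hflip`
  -- turns the `b²` term into an `a²` term. What remains is at most `c` times the variance, itself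
  -- at most `c / 2`.
  have hvar2 : ∫ x, (g x ^ 2) ^ 2 ∂Q - (∫ x, g x ^ 2 ∂Q) ^ 2 ≤ c ^ 2 := by
    have h1 := integral_sq_sub_sq_integral_le ν (hg.pow_const 2) (B := C ^ 2) fun x => by
      rw [abs_pow]
      exact pow_le_pow_left₀ (abs_nonneg _) (hgB x) 2
    have h2 : ∀ j, ∫ z, (G z ^ 2 - H j z ^ 2) ^ 2 ∂P
        ≤ 4 * ∫ z, (G z - H j z) ^ 2 * G z ^ 2 ∂P := by
      intro j
      calc ∫ z, (G z ^ 2 - H j z ^ 2) ^ 2 ∂P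
          ≤ ∫ z, 2 * ((G z - H j z) ^ 2 * G z ^ 2 + (G z - H j z) ^ 2 * H j z ^ 2) ∂P := by
            refine integral_mono_of_nonneg (ae_of_all _ fun z => sq_nonneg _)
              (((hintDG j).add (hintDH j)).const_mul 2) (ae_of_all _ fun z => ?_)
            simp only
            nlinarith [mul_nonneg (sq_nonneg (G z - H j z)) (sq_nonneg (G z - H j z))]
        _ = _ := by
            rw [integral_const_mul, integral_add (hintDG j) (hintDH j), hflip]
            ring
    have h3 : ∑ j, ∫ z, (G z - H j z) ^ 2 * G z ^ 2 ∂P ≤ c * ((1 / 2) * c) := by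
      rw [← integral_finsetSum _ fun j _ => hintDG j]
      have hc0 : 0 ≤ c := by linarith
      calc ∫ z, ∑ j, (G z - H j z) ^ 2 * G z ^ 2 ∂P ≤ ∫ z, c * G z ^ 2 ∂P := by
            refine integral_mono (integrable_finsetSum _ fun j _ => hintDG j)
              (hintG.const_mul c) fun z => ?_
            simp only
            rw [← Finset.sum_mul]
            exact mul_le_mul_of_nonneg_right (hgc (fun i => (z i).1) fun i => (z i).2)
              (sq_nonneg _)
        _ = c * ∫ x, g x ^ 2 ∂Q := by rw [integral_const_mul, hGQ]
        _ ≤ _ := mul_le_mul_of_nonneg_left hvar hc0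
    have h4 := Finset.sum_le_sum fun j (_ : j ∈ (Finset.univ : Finset ι)) => h2 j
    rw [← Finset.mul_sum] at h4
    simp only [G, H] at h3 h4
    nlinarith
  have h4 : ∀ x, (g x ^ 2) ^ 2 = (f x - m) ^ 4 := fun x => by
    simp only [g]
    ring
  simp_rw [h4] at hvar2
  nlinarith

end EfronStein

/-! ### Quadratic Taylor bounds for cosine and sine -/

/-- `ψ` is measurable and bounded by `1`, and its first-order Taylor expansion with derivative `u`
bounded by `1` has a uniform quadratic error. -/
structure HasQuadraticTaylor (ψ u : ℝ → ℝ) : Prop where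
  measurable : Measurable ψ
  abs_le : ∀ a, |ψ a| ≤ 1
  abs_deriv_le : ∀ a, |u a| ≤ 1
  taylor : ∀ a b, |ψ (a + b) - ψ a - u a * b| ≤ 3 * b ^ 2

theorem norm_exp_mul_I_sub_one_sub_le (b : ℝ) :
    ‖Complex.exp (b * Complex.I) - 1 - b * Complex.I‖ ≤ 3 * b ^ 2 := by
  have hn : ‖(b * Complex.I : ℂ)‖ = |b| := by simp
  by_cases h : |b| ≤ 1
  · refine (Complex.norm_exp_sub_one_sub_id_le (by rwa [hn])).trans ?_
    rw [hn, sq_abs]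
    nlinarith [sq_nonneg b]
  -- For `|b| > 1` the trivial bound `2 + |b|` is at most `3 * b ^ 2`; this case fixes the constant
  -- 3.
  · push Not at h
    refine (norm_sub_le _ _).trans ?_
    rw [hn]
    have : ‖Complex.exp (b * Complex.I) - 1‖ ≤ 2 := by
      refine (norm_sub_le _ _).trans ?_
      rw [Complex.norm_exp_ofReal_mul_I]
      norm_num
    have h2 : |b| ^ 2 = b ^ 2 := sq_abs b
    nlinarith

theorem norm_exp_mul_I_mul_le (a b : ℝ) :
    ‖Complex.exp (a * Complex.I) * (Complex.exp (b * Complex.I) - 1 - b * Complex.I)‖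
      ≤ 3 * b ^ 2 := by
  rw [norm_mul, Complex.norm_exp_ofReal_mul_I, one_mul]
  exact norm_exp_mul_I_sub_one_sub_le b

theorem hasQuadraticTaylor_cos : HasQuadraticTaylor Real.cos fun a => -Real.sin a where
  measurable := Real.measurable_cos
  abs_le := Real.abs_cos_le_one
  abs_deriv_le a := by
    rw [abs_neg]
    exact Real.abs_sin_le_one a
  taylor a b := by
    refine le_trans (le_of_eq ?_) ((Complex.abs_re_le_norm _).trans (norm_exp_mul_I_mul_le a b))
    congr 1
    simp only [Complex.exp_mul_I, ← Complex.ofReal_cos, ← Complex.ofReal_sin, Real.cos_add]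
    simp [Complex.cos_ofReal_re, Complex.sin_ofReal_re]
    ring

theorem hasQuadraticTaylor_sin : HasQuadraticTaylor Real.sin Real.cos where
  measurable := Real.measurable_sin
  abs_le := Real.abs_sin_le_one
  abs_deriv_le := Real.abs_cos_le_one
  taylor a b := by
    refine le_trans (le_of_eq ?_) ((Complex.abs_im_le_norm _).trans (norm_exp_mul_I_mul_le a b))
    congr 1
    simp only [Complex.exp_mul_I, ← Complex.ofReal_cos, ← Complex.ofReal_sin, Real.sin_add]
    simp [Complex.cos_ofReal_re, Complex.sin_ofReal_re]
    ring

/-! ### Concentration for bounded inputs -/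

/-- The average of `ψ (s * ·)` over the normalized eigenvalues of the symmetric circulant
matrix. -/
def circStat (ψ : ℝ → ℝ) (s : ℝ) (N : ℕ) [NeZero N] (x : Fin N → ℝ) : ℝ :=
  (N : ℝ)⁻¹ * ∑ k, ψ (s * (circEig N x k / √N))

section Concentration

variable {N : ℕ} [NeZero N]

theorem measurable_circEig (k : ZMod N) : Measurable fun x : Fin N → ℝ => circEig N x k := by
  unfold circEig
  fun_prop

theorem measurable_circStat {ψ : ℝ → ℝ} (hψ : Measurable ψ) (s : ℝ) :
    Measurable (circStat ψ s N) := by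
  unfold circStat
  exact (Finset.measurable_fun_sum _ fun k _ =>
    hψ.comp (((measurable_circEig k).div_const _).const_mul s)).const_mul _

theorem abs_inv_mul_sum_le {a : ZMod N → ℝ} {B : ℝ} (ha : ∀ k, |a k| ≤ B) :
    |(N : ℝ)⁻¹ * ∑ k, a k| ≤ B := by
  have hN : (0 : ℝ) < N := Nat.cast_pos.2 (Nat.pos_of_neZero N)
  rw [abs_mul, abs_of_pos (inv_pos.2 hN), inv_mul_le_iff₀ hN]
  refine (Finset.abs_sum_le_sum_abs _ _).trans ((Finset.sum_le_sum fun k _ => ha k).trans ?_)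
  simp

theorem abs_circStat_le {ψ : ℝ → ℝ} (hψ : ∀ a, |ψ a| ≤ 1) (s : ℝ) (x : Fin N → ℝ) :
    |circStat ψ s N x| ≤ 1 :=
  abs_inv_mul_sum_le fun _ => hψ _

theorem circEig_update (x : Fin N → ℝ) (j : Fin N) (a : ℝ) (k : ZMod N) :
    circEig N (Function.update x j a) k = circEig N x k + (a - x j) * circWeight N k j := by
  rw [circEig_eq_sum_weight, circEig_eq_sum_weight, ← Finset.add_sum_erase _ _ (Finset.mem_univ j),
    ← Finset.add_sum_erase (a := j) _ (fun i => x i * circWeight N k i) (Finset.mem_univ j),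
    Finset.sum_congr rfl (g := fun i => x i * circWeight N k i) fun i hi => by
      rw [Function.update_of_ne (Finset.ne_of_mem_erase hi)]]
  simp
  ring

/-- Changing input `j` shifts every eigenvalue linearly. The first-order term is kept as a sum over
`k`, so that Bessel can be used later; the remainder constant is 12 = 3 · 2². -/
theorem abs_circStat_update_sub_le {ψ u : ℝ → ℝ} (h : HasQuadraticTaylor ψ u) (s : ℝ)
    (x : Fin N → ℝ) (j : Fin N) (a : ℝ) {D : ℝ} (hD : |a - x j| ≤ D) :
    |circStat ψ s N (Function.update x j a) - circStat ψ s N x|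
      ≤ |s| * D / (N * √N) * |∑ k, u (s * (circEig N x k / √N)) * circWeight N k j|
        + 12 * s ^ 2 * D ^ 2 / N := by
  have hN : (0 : ℝ) < N := Nat.cast_pos.2 (Nat.pos_of_neZero N)
  have hsN : 0 < √(N : ℝ) := Real.sqrt_pos.2 hN
  have hsq : √(N : ℝ) ^ 2 = N := Real.sq_sqrt hN.le
  have hD0 : 0 ≤ D := (abs_nonneg _).trans hD
  set b : ZMod N → ℝ := fun k => s * (a - x j) / √N * circWeight N k j
  set v : ZMod N → ℝ := fun k => s * (circEig N x k / √N)
  have hb : ∀ k, b k ^ 2 ≤ 4 * s ^ 2 * D ^ 2 / N := by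
    intro k
    have h1 : (a - x j) ^ 2 ≤ D ^ 2 := by
      rw [← sq_abs]
      exact pow_le_pow_left₀ (abs_nonneg _) hD 2
    have h2 : circWeight N k j ^ 2 ≤ 4 := by
      rw [← sq_abs]
      exact (pow_le_pow_left₀ (abs_nonneg _) (abs_circWeight_le k j) 2).trans (by norm_num)
    have : b k ^ 2 = s ^ 2 * ((a - x j) ^ 2 * circWeight N k j ^ 2) / N := by
      simp only [b]
      rw [mul_pow, div_pow, hsq]
      ring
    rw [this]
    calc s ^ 2 * ((a - x j) ^ 2 * circWeight N k j ^ 2) / N ≤ s ^ 2 * (D ^ 2 * 4) / N := by gcongr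
      _ = _ := by ring
  have hsplit : circStat ψ s N (Function.update x j a) - circStat ψ s N x
      = (N : ℝ)⁻¹ * ∑ k, u (v k) * b k
        + (N : ℝ)⁻¹ * ∑ k, (ψ (v k + b k) - ψ (v k) - u (v k) * b k) := by
    have : ∀ k, s * (circEig N (Function.update x j a) k / √N) = v k + b k := by
      intro k
      rw [circEig_update]
      simp only [v, b]
      ring
    simp only [circStat, this]
    rw [← mul_sub, ← mul_add, ← Finset.sum_sub_distrib, ← Finset.sum_add_distrib]
    congr 1
    exact Finset.sum_congr rfl fun k _ => by ring
  rw [hsplit]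
  refine (abs_add_le _ _).trans (add_le_add ?_ ?_)
  · have : (N : ℝ)⁻¹ * ∑ k, u (v k) * b k
        = s * (a - x j) / (N * √N) * ∑ k, u (v k) * circWeight N k j := by
      rw [Finset.mul_sum, Finset.mul_sum]
      refine Finset.sum_congr rfl fun k _ => ?_
      simp only [b]
      field_simp
    rw [this, abs_mul, abs_div, abs_mul, abs_of_pos (mul_pos hN hsN)]
    gcongr
  · refine abs_inv_mul_sum_le fun k => (h.taylor _ _).trans ?_
    calc 3 * b k ^ 2 ≤ 3 * (4 * s ^ 2 * D ^ 2 / N) := by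
          have := hb k
          linarith
      _ = _ := by ring

/-- The linear terms sum by the dual Bessel bound, and the `N` squared remainders are each O(1/N²);
here 288 = 2 · 12². -/
theorem sum_sq_circStat_update_sub_le {ψ u : ℝ → ℝ} (h : HasQuadraticTaylor ψ u) (s : ℝ)
    (x y : Fin N → ℝ) {D : ℝ} (hD : ∀ j, |y j - x j| ≤ D) :
    ∑ j, (circStat ψ s N x - circStat ψ s N (Function.update x j (y j))) ^ 2
      ≤ (4 * s ^ 2 * D ^ 2 + 288 * s ^ 4 * D ^ 4) / N := by
  have hN : (0 : ℝ) < N := Nat.cast_pos.2 (Nat.pos_of_neZero N)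
  have hsN : 0 < √(N : ℝ) := Real.sqrt_pos.2 hN
  have hsq : √(N : ℝ) ^ 2 = N := Real.sq_sqrt hN.le
  set S : Fin N → ℝ := fun j => ∑ k, u (s * (circEig N x k / √N)) * circWeight N k j
  have hS : ∑ j, S j ^ 2 ≤ 2 * N * N := by
    refine (sum_sq_sum_circWeight_le _).trans ?_
    have : ∑ k : ZMod N, u (s * (circEig N x k / √N)) ^ 2 ≤ N := by
      calc ∑ k : ZMod N, u (s * (circEig N x k / √N)) ^ 2 ≤ ∑ k : ZMod N, (1 : ℝ) := by
            refine Finset.sum_le_sum fun k _ => ?_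
            rw [← sq_abs]
            exact pow_le_one₀ (abs_nonneg _) (h.abs_deriv_le _)
        _ = N := by simp
    gcongr
  calc ∑ j, (circStat ψ s N x - circStat ψ s N (Function.update x j (y j))) ^ 2
      ≤ ∑ j, (2 * (s ^ 2 * D ^ 2 / N ^ 3) * S j ^ 2 + 288 * s ^ 4 * D ^ 4 / N ^ 2) := by
        refine Finset.sum_le_sum fun j _ => ?_
        have h1 := abs_circStat_update_sub_le h s x j (y j) (hD j)
        rw [abs_sub_comm] at h1
        have h2 := pow_le_pow_left₀ (abs_nonneg _) h1 2
        rw [sq_abs] at h2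
        refine h2.trans ((add_sq_le).trans (le_of_eq ?_))
        rw [mul_pow, sq_abs, div_pow, mul_pow, mul_pow, sq_abs, hsq]
        simp only [S]
        field_simp
        ring
    _ = 2 * (s ^ 2 * D ^ 2 / N ^ 3) * ∑ j, S j ^ 2 + N * (288 * s ^ 4 * D ^ 4 / N ^ 2) := by
        rw [Finset.sum_add_distrib, ← Finset.mul_sum]
        simp
    _ ≤ 2 * (s ^ 2 * D ^ 2 / N ^ 3) * (2 * N * N) + N * (288 * s ^ 4 * D ^ 4 / N ^ 2) := by
        gcongr
    _ = _ := by
        field_simp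
        ring

end Concentration

/-- Random variables whose fourth moments are summable tend to zero almost surely. -/
theorem ae_tendsto_zero_of_integral_pow_four_le {Ω : Type*} [MeasurableSpace Ω] {μ : Measure Ω}
    {G : ℕ → Ω → ℝ} (hG : ∀ n, Integrable (fun ω => G n ω ^ 4) μ) {a : ℕ → ℝ} (ha : Summable a)
    (h : ∀ n, ∫ ω, G n ω ^ 4 ∂μ ≤ a n) :
    ∀ᵐ ω ∂μ, Tendsto (fun n => G n ω) atTop (𝓝 0) := by
  have h4 : ∀ n ω, 0 ≤ G n ω ^ 4 := fun n ω => by positivity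
  have hmeas : ∀ n, AEMeasurable (fun ω => ENNReal.ofReal (G n ω ^ 4)) μ := fun n =>
    (hG n).aemeasurable.ennreal_ofReal
  have hfin : ∫⁻ ω, ∑' n, ENNReal.ofReal (G n ω ^ 4) ∂μ ≠ ⊤ := by
    rw [lintegral_tsum hmeas]
    have : ∀ n, ∫⁻ ω, ENNReal.ofReal (G n ω ^ 4) ∂μ ≤ ENNReal.ofReal (a n) := fun n => by
      rw [← ofReal_integral_eq_lintegral_ofReal (hG n) (ae_of_all _ (h4 n))]
      exact ENNReal.ofReal_le_ofReal (h n)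
    exact ne_top_of_le_ne_top ha.tsum_ofReal_ne_top (ENNReal.tsum_le_tsum this)
  filter_upwards [ae_lt_top' (AEMeasurable.tsum hmeas) hfin] with ω hω
  have h1 := ENNReal.tendsto_atTop_zero_of_tsum_ne_top hω.ne
  have h2 : Tendsto (fun n => G n ω ^ 4) atTop (𝓝 0) := by
    have := (ENNReal.tendsto_toReal ENNReal.zero_ne_top).comp h1
    simpa [Function.comp_def, ENNReal.toReal_ofReal (h4 _ ω)] using this
  -- The iterated square root of a fourth power is the absolute value.
  have h3 : Tendsto (fun n => √√(G n ω ^ 4)) atTop (𝓝 0) := by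
    simpa using h2.sqrt.sqrt
  refine (tendsto_zero_iff_abs_tendsto_zero _).2 (h3.congr fun n => ?_)
  rw [show G n ω ^ 4 = (G n ω ^ 2) ^ 2 by ring, Real.sqrt_sq (sq_nonneg _), Real.sqrt_sq_eq_abs]
  rfl

section Iid

variable {Ω : Type*} [MeasurableSpace Ω] {μ : Measure Ω} [IsProbabilityMeasure μ] {X : ℕ → Ω → ℝ}

theorem map_restrict_eq_pi (hindep : iIndepFun X μ) (hident : ∀ j, IdentDistrib (X j) (X 0) μ μ)
    (N : ℕ) :
    μ.map (fun ω (j : Fin N) => X j ω) = Measure.pi fun _ : Fin N => μ.map (X 0) := by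
  have h := (iIndepFun_iff_map_fun_eq_pi_map (f := fun j : Fin N => X j)
    fun j => (hident j).aemeasurable_fst).1 (hindep.precomp Fin.val_injective)
  rw [h]
  congr
  funext j
  exact (hident j).map_eq

theorem integral_circStat_sub_pow_four_le (hindep : iIndepFun X μ)
    (hident : ∀ j, IdentDistrib (X j) (X 0) μ μ) {T : ℝ → ℝ} (hT : Measurable T) {D : ℝ}
    (hTD : ∀ a, |T a| ≤ D) {ψ u : ℝ → ℝ} (h : HasQuadraticTaylor ψ u) (s : ℝ)
    (N : ℕ) [NeZero N] :
    ∫ ω, (circStat ψ s N (fun j => T (X j ω))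
        - ∫ ω', circStat ψ s N (fun j => T (X j ω')) ∂μ) ^ 4 ∂μ
      ≤ 2 * ((4 * s ^ 2 * (2 * D) ^ 2 + 288 * s ^ 4 * (2 * D) ^ 4) / N) ^ 2 := by
  have : IsProbabilityMeasure (μ.map (X 0)) :=
    Measure.isProbabilityMeasure_map (hident 0).aemeasurable_fst
  set f : (Fin N → ℝ) → ℝ := fun x => circStat ψ s N fun j => T (x j)
  have hf : Measurable f := (measurable_circStat h.measurable s).comp
    (measurable_pi_lambda _ fun j => hT.comp (measurable_pi_apply j))
  have hX : AEMeasurable (fun ω (j : Fin N) => X j ω) μ :=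
    aemeasurable_pi_iff.2 fun j => (hident j).aemeasurable_fst
  have key := integral_sub_integral_pow_four_le (μ.map (X 0)) hf (B := 1)
    (fun x => abs_circStat_le h.abs_le s _)
    (c := (4 * s ^ 2 * (2 * D) ^ 2 + 288 * s ^ 4 * (2 * D) ^ 4) / N) ?_
  · rw [← map_restrict_eq_pi hindep hident N, integral_map hX hf.aestronglyMeasurable,
      integral_map hX ((hf.sub_const _).pow_const 4).aestronglyMeasurable] at key
    exact key
  · intro x y
    have hupd : ∀ j, f (Function.update x j (y j))
        = circStat ψ s N (Function.update (fun i => T (x i)) j (T (y j))) := by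
      intro j
      simp only [f]
      congr 1
      funext i
      by_cases hij : i = j
      · subst hij
        simp
      · simp [hij]
    simp only [hupd]
    refine sum_sq_circStat_update_sub_le h s (fun i => T (x i)) (fun i => T (y i)) fun j => ?_
    exact (abs_sub _ _).trans (by linarith [hTD (x j), hTD (y j)])

/-- The variance bound O(1/N) is not summable in `N`; the fourth moment bound O(1/N²) is. -/
theorem ae_tendsto_circStat_sub_integral (hindep : iIndepFun X μ)
    (hident : ∀ j, IdentDistrib (X j) (X 0) μ μ) {T : ℝ → ℝ} (hT : Measurable T) {D : ℝ}
    (hTD : ∀ a, |T a| ≤ D) {ψ u : ℝ → ℝ} (h : HasQuadraticTaylor ψ u) (s : ℝ) :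
    ∀ᵐ ω ∂μ, Tendsto (fun n : ℕ => circStat ψ s (n + 1) (fun j => T (X j ω))
        - ∫ ω', circStat ψ s (n + 1) (fun j => T (X j ω')) ∂μ) atTop (𝓝 0) := by
  have hX : ∀ n : ℕ, AEMeasurable (fun ω => circStat ψ s (n + 1) fun j => T (X j ω)) μ := fun n =>
    (measurable_circStat h.measurable s).comp_aemeasurable
      (aemeasurable_pi_iff.2 fun j => hT.comp_aemeasurable (hident j).aemeasurable_fst)
  refine ae_tendsto_zero_of_integral_pow_four_le (fun n => ?_)
    (a := fun n => 2 * (4 * s ^ 2 * (2 * D) ^ 2 + 288 * s ^ 4 * (2 * D) ^ 4) ^ 2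
      * (1 / ((n + 1 : ℕ) : ℝ) ^ 2))
    (((summable_nat_add_iff 1).2 (Real.summable_one_div_nat_pow.2 one_lt_two)).mul_left _)
    fun n => (integral_circStat_sub_pow_four_le hindep hident hT hTD h s (n + 1)).trans
      (le_of_eq (by rw [div_pow]; ring))
  refine Integrable.of_bound (((hX n).sub_const _).pow_const 4).aestronglyMeasurable (2 ^ 4)
    (ae_of_all _ fun ω => ?_)
  rw [norm_pow]
  refine pow_le_pow_left₀ (norm_nonneg _) ?_ 4
  refine (norm_sub_le _ _).trans ?_
  have h1 : ‖circStat ψ s (n + 1) (fun j => T (X j ω))‖ ≤ 1 := abs_circStat_le h.abs_le s _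
  have h2 : ‖∫ ω', circStat ψ s (n + 1) (fun j => T (X j ω')) ∂μ‖ ≤ 1 := by
    refine (norm_integral_le_of_norm_le_const (C := 1)
      (ae_of_all _ fun ω' => abs_circStat_le h.abs_le s _)).trans ?_
    simp
  linarith

end Iid

/-! ### The expected empirical characteristic function -/

/-- The characteristic function of the empirical distribution of the normalized eigenvalues of the
symmetric circulant matrix. -/
def circCF (s : ℝ) (N : ℕ) [NeZero N] (x : Fin N → ℝ) : ℂ :=
  (N : ℂ)⁻¹ * ∑ k, Complex.exp ((s * (circEig N x k / √N) : ℝ) * Complex.I)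

theorem circCF_eq (s : ℝ) (N : ℕ) [NeZero N] (x : Fin N → ℝ) :
    circCF s N x = circStat Real.cos s N x + circStat Real.sin s N x * Complex.I := by
  simp only [circCF, circStat, Complex.exp_mul_I]
  push_cast
  rw [Finset.sum_add_distrib, ← Finset.sum_mul]
  ring

/-- Factors are replaced one at a time, as in Lindeberg's argument, while the others stay in the
unit disc. -/
theorem norm_prod_sub_prod_le {ι : Type*} (S : Finset ι) (a b : ι → ℂ) (ha : ∀ i, ‖a i‖ ≤ 1)
    (hb : ∀ i, ‖b i‖ ≤ 1) : ‖∏ i ∈ S, a i - ∏ i ∈ S, b i‖ ≤ ∑ i ∈ S, ‖a i - b i‖ := by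
  classical
  induction S using Finset.induction_on with
  | empty => simp
  | insert j S hj ih =>
    rw [Finset.prod_insert hj, Finset.prod_insert hj, Finset.sum_insert hj]
    have h1 : ‖∏ i ∈ S, a i‖ ≤ 1 := by
      rw [norm_prod]
      exact Finset.prod_le_one (fun _ _ => norm_nonneg _) fun i _ => ha i
    calc ‖a j * ∏ i ∈ S, a i - b j * ∏ i ∈ S, b i‖
        = ‖(a j - b j) * ∏ i ∈ S, a i + b j * (∏ i ∈ S, a i - ∏ i ∈ S, b i)‖ := by ring_nf
      _ ≤ ‖a j - b j‖ * ‖∏ i ∈ S, a i‖ + ‖b j‖ * ‖∏ i ∈ S, a i - ∏ i ∈ S, b i‖ := by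
          rw [← norm_mul, ← norm_mul]
          exact norm_add_le _ _
      _ ≤ ‖a j - b j‖ * 1 + 1 * ∑ i ∈ S, ‖a i - b i‖ := by
          gcongr
          exact hb j
      _ = _ := by ring

theorem norm_cexp_neg_sub_cexp_neg_le {a b : ℝ} (ha : 0 ≤ a) (hb : 0 ≤ b) :
    ‖Complex.exp (-a : ℝ) - Complex.exp (-b : ℝ)‖ ≤ |a - b| := by
  rw [← Complex.ofReal_exp, ← Complex.ofReal_exp, ← Complex.ofReal_sub, Complex.norm_real,
    Real.norm_eq_abs]
  wlog h : a ≤ b generalizing a b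
  · rw [abs_sub_comm, abs_sub_comm a]
    exact this hb ha (le_of_not_ge h)
  have h1 : Real.exp (-b) ≤ Real.exp (-a) := Real.exp_le_exp.2 (by linarith)
  rw [abs_of_nonneg (by linarith), abs_sub_comm, abs_of_nonneg (by linarith)]
  have h2 : Real.exp (-b) = Real.exp (-a) * Real.exp (-(b - a)) := by
    rw [← Real.exp_add]
    ring_nf
  have h3 : 1 - (b - a) ≤ Real.exp (-(b - a)) := Real.one_sub_le_exp_neg _
  have h4 : Real.exp (-a) ≤ 1 := Real.exp_le_one_iff.2 (by linarith)
  have h5 := Real.exp_pos (-a)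
  nlinarith

theorem norm_inv_mul_sum_le {N : ℕ} [NeZero N] (a : ZMod N → ℂ) :
    ‖(N : ℂ)⁻¹ * ∑ k, a k‖ ≤ (N : ℝ)⁻¹ * ∑ k, ‖a k‖ := by
  rw [norm_mul, norm_inv, Complex.norm_natCast]
  exact mul_le_mul_of_nonneg_left (norm_sum_le _ _) (by positivity)

theorem norm_circCF_le (s : ℝ) (N : ℕ) [NeZero N] (x : Fin N → ℝ) : ‖circCF s N x‖ ≤ 1 := by
  refine (norm_inv_mul_sum_le _).trans ?_
  simp only [Complex.norm_exp_ofReal_mul_I]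
  simp [NeZero.ne N]

theorem measurable_circCF (s : ℝ) (N : ℕ) [NeZero N] : Measurable (circCF s N) := by
  rw [funext (circCF_eq s N)]
  have h1 := measurable_circStat (N := N) Real.measurable_cos s
  have h2 := measurable_circStat (N := N) Real.measurable_sin s
  fun_prop

section Mean

variable {Ω : Type*} [MeasurableSpace Ω] {μ : Measure Ω} {X : ℕ → Ω → ℝ}

theorem integral_cexp_circEig (hindep : iIndepFun X μ)
    (hident : ∀ j, IdentDistrib (X j) (X 0) μ μ) (s : ℝ) (N : ℕ) [NeZero N] (k : ZMod N) :
    ∫ ω, Complex.exp ((s * (circEig N (fun j => X j ω) k / √N) : ℝ) * Complex.I) ∂μ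
      = ∏ j, charFun (μ.map (X 0)) (circWeight N k j / √N * s) := by
  have hX : ∀ j, AEMeasurable (X j) μ := fun j => (hident j).aemeasurable_fst
  have hY : ∀ j : Fin N, AEMeasurable (fun ω => circWeight N k j / √N * X j ω) μ := fun j =>
    (hX j).const_mul _
  have hind : iIndepFun (fun (j : Fin N) ω => circWeight N k j / √N * X j ω) μ :=
    (hindep.precomp Fin.val_injective).comp (fun j a => circWeight N k j / √N * a)
      fun j => measurable_const_mul _
  have h := congrFun (hind.charFun_map_fun_sum_eq_prod hY) s
  rw [Finset.prod_apply, charFun_apply_real, integral_map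
    (Finset.aemeasurable_fun_sum _ fun j _ => hY j) (by fun_prop)] at h
  convert! h using 1
  · refine integral_congr_ae (ae_of_all _ fun ω => ?_)
    simp only [circEig_eq_sum_weight]
    rw [← Complex.ofReal_mul, Finset.sum_div]
    simp only [mul_comm, mul_div_assoc]
  · refine Finset.prod_congr rfl fun j _ => ?_
    rw [← (hident j).map_eq, ← charFun_map_mul, AEMeasurable.map_map_of_aemeasurable
      (measurable_const_mul _).aemeasurable (hX j)]
    rfl

/-- Both laws have mean 0 and second moment 1, hence the same second-order expansion at 0; the
difference is o(t²). -/
theorem eventually_norm_charFun_sub_gaussian_le [IsProbabilityMeasure μ] {Y : Ω → ℝ}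
    (hY : AEMeasurable Y μ)
    (h0 : ∫ ω, Y ω ∂μ = 0) (h1 : ∫ ω, (Y ^ 2) ω ∂μ = 1) {δ : ℝ} (hδ : 0 < δ) :
    ∀ᶠ t : ℝ in 𝓝 0,
      ‖charFun (μ.map Y) t - Complex.exp (-(t ^ 2 / 2) : ℝ)‖ ≤ δ * t ^ 2 := by
  have hY2 := taylor_charFun_two hY h0 h1
  have hG := taylor_charFun_two (P := gaussianReal 0 1) (X := id) aemeasurable_id
    (by simp) (by
      have := variance_id_gaussianReal (μ := 0) (v := 1)
      rw [variance_of_integral_eq_zero aemeasurable_id (by simp)] at this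
      simpa using this)
  have h := (hY2.sub hG).def hδ
  filter_upwards [h] with t ht
  rw [Measure.map_id, charFun_gaussianReal] at ht
  simp only [sub_sub_sub_cancel_right, norm_pow, Real.norm_eq_abs, sq_abs] at ht
  convert! ht using 4
  push_cast
  simp

/-- For each `k`, the passage to a Gaussian of variance `V k ≤ 4` costs `4 * δ * s ^ 2`, and the
correction of `V k` to 1 costs `s ^ 2 / 2 * |V k - 1|`. Only the average over `k` of the latter is
small, since `V k` is far from 1 when `2 * k = 0`. -/
theorem norm_integral_circCF_sub_le [IsProbabilityMeasure μ] (hindep : iIndepFun X μ)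
    (hident : ∀ j, IdentDistrib (X j) (X 0) μ μ) (s : ℝ) (N : ℕ) [NeZero N] {δ : ℝ}
    (hδ : ∀ (k : ZMod N) j, ‖charFun (μ.map (X 0)) (circWeight N k j / √N * s)
      - Complex.exp (-((circWeight N k j / √N * s) ^ 2 / 2) : ℝ)‖
        ≤ δ * (circWeight N k j / √N * s) ^ 2) (hδ0 : 0 ≤ δ) :
    ‖∫ ω, circCF s N (fun j => X j ω) ∂μ - Complex.exp (-(s ^ 2 / 2) : ℝ)‖
      ≤ 4 * δ * s ^ 2 + 2 * s ^ 2 / N := by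
  have hN : (0 : ℝ) < N := Nat.cast_pos.2 (Nat.pos_of_neZero N)
  have hsq : √(N : ℝ) ^ 2 = N := Real.sq_sqrt hN.le
  have : IsProbabilityMeasure (μ.map (X 0)) :=
    Measure.isProbabilityMeasure_map (hident 0).aemeasurable_fst
  set V : ZMod N → ℝ := fun k => (∑ j, circWeight N k j ^ 2) / N
  have hV0 : ∀ k, 0 ≤ V k := fun k =>
    div_nonneg (Finset.sum_nonneg fun _ _ => sq_nonneg _) hN.le
  have hV4 : ∀ k, V k ≤ 4 := by
    intro k
    rw [div_le_iff₀ hN]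
    calc ∑ j, circWeight N k j ^ 2 ≤ ∑ j : Fin N, (4 : ℝ) := by
          refine Finset.sum_le_sum fun j _ => ?_
          rw [← sq_abs]
          exact (pow_le_pow_left₀ (abs_nonneg _) (abs_circWeight_le k j) 2).trans (by norm_num)
      _ = 4 * N := by
          simp
          ring
  have hsum : ∀ k, ∑ j, (circWeight N k j / √N * s) ^ 2 = s ^ 2 * V k := by
    intro k
    simp only [V, mul_pow, div_pow, hsq]
    rw [← Finset.sum_mul, ← Finset.sum_div]
    ring
  set I : ZMod N → ℂ := fun k =>
    ∫ ω, Complex.exp ((s * (circEig N (fun j => X j ω) k / √N) : ℝ) * Complex.I) ∂μ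
  have hterm : ∀ k, ‖I k - Complex.exp (-(s ^ 2 / 2) : ℝ)‖
      ≤ 4 * δ * s ^ 2 + s ^ 2 / 2 * |V k - 1| := by
    intro k
    have h1 : ‖I k - Complex.exp (-(s ^ 2 / 2 * V k) : ℝ)‖ ≤ δ * (s ^ 2 * V k) := by
      have hprod : Complex.exp (-(s ^ 2 / 2 * V k) : ℝ)
          = ∏ j, Complex.exp (-((circWeight N k j / √N * s) ^ 2 / 2) : ℝ) := by
        rw [← Complex.exp_sum, ← Complex.ofReal_sum, Finset.sum_neg_distrib, ← Finset.sum_div,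
          hsum]
        congr 2
        ring
      simp only [I]
      rw [integral_cexp_circEig hindep hident, hprod, ← hsum, Finset.mul_sum]
      refine (norm_prod_sub_prod_le _ _ _ (fun j => norm_charFun_le_one _) fun j => ?_).trans
        (Finset.sum_le_sum fun j _ => hδ k j)
      rw [Complex.norm_exp, Complex.ofReal_re]
      exact Real.exp_le_one_iff.2 (by have := sq_nonneg (circWeight N k j / √N * s); linarith)
    have h2 : ‖Complex.exp (-(s ^ 2 / 2 * V k) : ℝ) - Complex.exp (-(s ^ 2 / 2) : ℝ)‖
        ≤ s ^ 2 / 2 * |V k - 1| := by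
      refine (norm_cexp_neg_sub_cexp_neg_le (mul_nonneg (by positivity) (hV0 k))
        (by positivity)).trans (le_of_eq ?_)
      rw [show s ^ 2 / 2 * V k - s ^ 2 / 2 = s ^ 2 / 2 * (V k - 1) by ring, abs_mul,
        abs_of_nonneg (by positivity)]
    have h3 : δ * (s ^ 2 * V k) ≤ 4 * δ * s ^ 2 := by
      have := mul_le_mul_of_nonneg_left (hV4 k) (mul_nonneg hδ0 (sq_nonneg s))
      linarith
    have h4 := norm_sub_le_norm_sub_add_norm_sub (I k) (Complex.exp (-(s ^ 2 / 2 * V k) : ℝ))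
      (Complex.exp (-(s ^ 2 / 2) : ℝ))
    linarith
  have hint : ∫ ω, circCF s N (fun j => X j ω) ∂μ = (N : ℂ)⁻¹ * ∑ k, I k := by
    simp only [circCF, I]
    rw [integral_const_mul, integral_finsetSum]
    intro k _
    refine Integrable.of_bound (C := 1) ?_ (ae_of_all _ fun ω => ?_)
    · have hX : AEMeasurable (fun ω => circEig N (fun j => X j ω) k) μ :=
        (measurable_circEig k).comp_aemeasurable
          (aemeasurable_pi_iff.2 fun j => (hident j).aemeasurable_fst)
      exact AEMeasurable.aestronglyMeasurable (by fun_prop)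
    · rw [Complex.norm_exp_ofReal_mul_I]
  have hNc : (N : ℂ) ≠ 0 := Nat.cast_ne_zero.2 (NeZero.ne N)
  have hconst : Complex.exp (-(s ^ 2 / 2) : ℝ)
      = (N : ℂ)⁻¹ * ∑ k : ZMod N, Complex.exp (-(s ^ 2 / 2) : ℝ) := by
    simp [hNc]
  rw [hint, hconst, ← mul_sub, ← Finset.sum_sub_distrib]
  refine (norm_inv_mul_sum_le _).trans ?_
  have hVsum : ∑ k, |V k - 1| ≤ 4 := by
    have h1 : ∀ k, |V k - 1| = |∑ j, circWeight N k j ^ 2 - N| / N := by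
      intro k
      simp only [V]
      rw [div_sub_one hN.ne', abs_div, abs_of_pos hN]
    simp_rw [h1]
    rw [← Finset.sum_div, div_le_iff₀ hN]
    exact sum_abs_sum_circWeight_sq_sub_le
  rw [inv_mul_le_iff₀ hN]
  refine (Finset.sum_le_sum fun k _ => hterm k).trans ?_
  rw [Finset.sum_add_distrib, ← Finset.mul_sum _ (fun k => |V k - 1|)]
  have h5 : s ^ 2 / 2 * ∑ k, |V k - 1| ≤ s ^ 2 / 2 * 4 := by gcongr
  have h6 : (N : ℝ) * (4 * δ * s ^ 2 + 2 * s ^ 2 / N) = N * (4 * δ * s ^ 2) + s ^ 2 / 2 * 4 := by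
    field_simp
    ring
  rw [h6]
  simp only [Finset.sum_const, Finset.card_univ, ZMod.card, nsmul_eq_mul]
  linarith

/-- The expected empirical characteristic function converges to that of `N(0, 1)`. -/
theorem tendsto_integral_circCF [IsProbabilityMeasure μ] (hindep : iIndepFun X μ)
    (hident : ∀ j, IdentDistrib (X j) (X 0) μ μ) (h0 : ∫ ω, X 0 ω ∂μ = 0)
    (h1 : ∫ ω, (X 0 ^ 2) ω ∂μ = 1) (s : ℝ) :
    Tendsto (fun n : ℕ => ∫ ω, circCF s (n + 1) (fun j => X j ω) ∂μ) atTop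
      (𝓝 (Complex.exp (-(s ^ 2 / 2) : ℝ))) := by
  rw [Metric.tendsto_atTop']
  intro ε hε
  set δ := ε / (8 * (s ^ 2 + 1))
  have hδ : 0 < δ := by positivity
  obtain ⟨r, hr, hball⟩ := Metric.eventually_nhds_iff.1
    (eventually_norm_charFun_sub_gaussian_le (hident 0).aemeasurable_fst h0 h1 hδ)
  have hcast : Tendsto (fun n : ℕ => ((n + 1 : ℕ) : ℝ)) atTop atTop :=
    tendsto_natCast_atTop_atTop.comp (tendsto_add_atTop_nat 1)
  have hsqrt : ∀ᶠ n : ℕ in atTop, 2 * |s| / √((n + 1 : ℕ) : ℝ) < r :=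
    ((Real.tendsto_sqrt_atTop.comp hcast).const_div_atTop (2 * |s|)).eventually_lt_const hr
  have hinv : ∀ᶠ n : ℕ in atTop, 2 * s ^ 2 / ((n + 1 : ℕ) : ℝ) < ε / 2 :=
    (hcast.const_div_atTop _).eventually_lt_const (half_pos hε)
  obtain ⟨n₀, hn₀⟩ := eventually_atTop.1 (hsqrt.and hinv)
  refine ⟨n₀, fun n hn => ?_⟩
  obtain ⟨h2, h3⟩ := hn₀ n hn.le
  rw [dist_eq_norm]
  have hsp : 0 < √((n + 1 : ℕ) : ℝ) := Real.sqrt_pos.2 (by positivity)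
  refine (norm_integral_circCF_sub_le hindep hident s (n + 1) (δ := δ) (fun k j => hball ?_)
    hδ.le).trans_lt ?_
  · rw [dist_zero_right, Real.norm_eq_abs, abs_mul, abs_div, abs_of_pos hsp]
    refine lt_of_le_of_lt ?_ h2
    rw [div_mul_eq_mul_div]
    have := abs_circWeight_le k j
    gcongr
  · have h4 : 4 * δ * s ^ 2 ≤ ε / 2 := by
      have : 4 * δ * (s ^ 2 + 1) = ε / 2 := by
        simp only [δ]
        field_simp
        ring
      nlinarith
    linarith

end Mean

/-! ### Continuity in the inputs and in the argument -/

theorem norm_cexp_mul_I_sub_le (a b : ℝ) :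
    ‖Complex.exp (a * Complex.I) - Complex.exp (b * Complex.I)‖ ≤ |a - b| := by
  have h : Complex.exp (a * Complex.I) - Complex.exp (b * Complex.I)
      = Complex.exp (b * Complex.I) * (Complex.exp (Complex.I * (a - b : ℝ)) - 1) := by
    rw [mul_sub, ← Complex.exp_add]
    push_cast
    ring_nf
  rw [h, norm_mul, Complex.norm_exp_ofReal_mul_I, one_mul]
  exact Real.norm_exp_I_mul_ofReal_sub_one_le

/-- From `a ≤ δ + a² / δ` and the second moment bound. The free `δ` keeps the estimate linear in the
mean square, so it can be integrated directly. -/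
theorem average_abs_circEig_le {N : ℕ} [NeZero N] (x : Fin N → ℝ) {δ : ℝ} (hδ : 0 < δ) :
    (N : ℝ)⁻¹ * ∑ k, |circEig N x k| / √N ≤ δ + 2 / δ * ((∑ j, x j ^ 2) / N) := by
  have hN : (0 : ℝ) < N := Nat.cast_pos.2 (Nat.pos_of_neZero N)
  have hsN : 0 < √(N : ℝ) := Real.sqrt_pos.2 hN
  have hsq : √(N : ℝ) ^ 2 = N := Real.sq_sqrt hN.le
  have hterm : ∀ k, |circEig N x k| / √N ≤ δ + 1 / (δ * N) * circEig N x k ^ 2 := by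
    intro k
    have h1 : 1 / (δ * N) * circEig N x k ^ 2 = (|circEig N x k| / √N) ^ 2 / δ := by
      rw [div_pow, sq_abs, hsq]
      field_simp
    rw [h1]
    set a := |circEig N x k| / √N
    rw [← sub_nonneg]
    have h2 : δ + a ^ 2 / δ - a = (δ ^ 2 + a ^ 2 - a * δ) / δ := by field_simp
    rw [h2]
    exact div_nonneg (by nlinarith [sq_nonneg (δ - a), sq_nonneg δ, sq_nonneg a]) hδ.le
  rw [inv_mul_le_iff₀ hN]
  refine (Finset.sum_le_sum fun k _ => hterm k).trans ?_
  rw [Finset.sum_add_distrib, ← Finset.mul_sum _ (fun k => circEig N x k ^ 2)]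
  have h3 : 1 / (δ * N) * ∑ k, circEig N x k ^ 2 ≤ 1 / (δ * N) * (2 * N * ∑ j, x j ^ 2) := by
    gcongr
    exact sum_circEig_sq_le x
  have h4 : 1 / (δ * N) * (2 * N * ∑ j, x j ^ 2)
      = N * (2 / δ * ((∑ j, x j ^ 2) / N)) := by field_simp
  simp only [Finset.sum_const, Finset.card_univ, ZMod.card, nsmul_eq_mul]
  linarith

/-- The empirical characteristic function is continuous in the input sequence, with respect to the
mean square distance. -/
theorem norm_circCF_sub_circCF_le {N : ℕ} [NeZero N] (s : ℝ) (x y : Fin N → ℝ) {δ : ℝ}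
    (hδ : 0 < δ) :
    ‖circCF s N x - circCF s N y‖ ≤ |s| * (δ + 2 / δ * ((∑ j, (x j - y j) ^ 2) / N)) := by
  have hsN : 0 ≤ √(N : ℝ) := Real.sqrt_nonneg _
  simp only [circCF]
  rw [← mul_sub, ← Finset.sum_sub_distrib]
  refine (norm_inv_mul_sum_le _).trans ?_
  calc _ ≤ (N : ℝ)⁻¹ * ∑ k, |s| * (|circEig N (fun j => x j - y j) k| / √N) := by
        gcongr with k
        refine (norm_cexp_mul_I_sub_le _ _).trans (le_of_eq ?_)
        rw [← mul_sub, ← sub_div, abs_mul, abs_div, abs_of_nonneg hsN, circEig_sub]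
    _ = |s| * ((N : ℝ)⁻¹ * ∑ k, |circEig N (fun j => x j - y j) k| / √N) := by
        rw [← Finset.mul_sum]
        ring
    _ ≤ _ := by
        gcongr
        exact average_abs_circEig_le _ hδ

/-- The empirical characteristic function is Lipschitz in its argument. -/
theorem norm_circCF_sub_circCF_le' {N : ℕ} [NeZero N] (s t : ℝ) (x : Fin N → ℝ) :
    ‖circCF s N x - circCF t N x‖ ≤ |s - t| * (1 + 2 * ((∑ j, x j ^ 2) / N)) := by
  have hsN : 0 ≤ √(N : ℝ) := Real.sqrt_nonneg _
  simp only [circCF]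
  rw [← mul_sub, ← Finset.sum_sub_distrib]
  refine (norm_inv_mul_sum_le _).trans ?_
  calc _ ≤ (N : ℝ)⁻¹ * ∑ k, |s - t| * (|circEig N x k| / √N) := by
        gcongr with k
        refine (norm_cexp_mul_I_sub_le _ _).trans (le_of_eq ?_)
        rw [← sub_mul, abs_mul, abs_div, abs_of_nonneg hsN]
    _ = |s - t| * ((N : ℝ)⁻¹ * ∑ k, |circEig N x k| / √N) := by
        rw [← Finset.mul_sum]
        ring
    _ ≤ _ := by
        gcongr
        exact (average_abs_circEig_le x one_pos).trans (le_of_eq (by ring))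

/-! ### Truncation and concentration for square integrable inputs -/

/-- Truncation of a real number at level `m`. -/
def clip (m : ℕ) (a : ℝ) : ℝ := (Set.Icc (-(m : ℝ)) m).indicator id a

theorem measurable_clip (m : ℕ) : Measurable (clip m) :=
  measurable_id.indicator measurableSet_Icc

theorem abs_clip_le (m : ℕ) (a : ℝ) : |clip m a| ≤ m := by
  by_cases h : a ∈ Set.Icc (-(m : ℝ)) m
  · rw [clip, Set.indicator_of_mem h]
    exact abs_le.2 h
  · simp [clip, Set.indicator_of_notMem h]

theorem sq_sub_clip_le (m : ℕ) (a : ℝ) : (a - clip m a) ^ 2 ≤ a ^ 2 := by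
  by_cases h : a ∈ Set.Icc (-(m : ℝ)) m
  · rw [clip, Set.indicator_of_mem h]
    simpa using sq_nonneg a
  · simp [clip, Set.indicator_of_notMem h]

theorem tendsto_clip (a : ℝ) : Tendsto (fun m => (a - clip m a) ^ 2) atTop (𝓝 0) := by
  obtain ⟨m₀, hm₀⟩ := exists_nat_ge |a|
  refine tendsto_const_nhds.congr' ?_
  filter_upwards [eventually_ge_atTop m₀] with m hm
  have h : a ∈ Set.Icc (-(m : ℝ)) m :=
    abs_le.1 (hm₀.trans (by exact_mod_cast hm))
  rw [clip, Set.indicator_of_mem h]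
  simp

section Iid

variable {Ω : Type*} [MeasurableSpace Ω] {μ : Measure Ω} {X : ℕ → Ω → ℝ}

theorem tendsto_integral_sq_sub_clip {Y : Ω → ℝ} (hY : AEMeasurable Y μ)
    (hY2 : Integrable (fun ω => Y ω ^ 2) μ) :
    Tendsto (fun m => ∫ ω, (Y ω - clip m (Y ω)) ^ 2 ∂μ) atTop (𝓝 0) := by
  have h := tendsto_integral_of_dominated_convergence (μ := μ)
    (F := fun m ω => (Y ω - clip m (Y ω)) ^ 2) (f := fun _ => (0 : ℝ)) (fun ω => Y ω ^ 2)
    (fun m => ((hY.sub ((measurable_clip m).comp_aemeasurable hY)).pow_const 2).aestronglyMeasurable)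
    hY2 (fun m => ae_of_all _ fun ω => by
      rw [Real.norm_eq_abs, abs_of_nonneg (sq_nonneg _)]
      exact sq_sub_clip_le m _)
    (ae_of_all _ fun ω => tendsto_clip _)
  simpa using h

theorem ae_tendsto_average (hindep : iIndepFun X μ) (hident : ∀ j, IdentDistrib (X j) (X 0) μ μ)
    {φ : ℝ → ℝ} (hφ : Measurable φ) (hint : Integrable (fun ω => φ (X 0 ω)) μ) :
    ∀ᵐ ω ∂μ, Tendsto (fun n : ℕ => (∑ j : Fin (n + 1), φ (X j ω)) / ((n + 1 : ℕ) : ℝ)) atTop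
      (𝓝 (∫ ω, φ (X 0 ω) ∂μ)) := by
  have h := strong_law_ae_real (fun j ω => φ (X j ω)) hint
    (fun i j hij => (hindep.indepFun hij).comp hφ hφ) fun j => (hident j).comp hφ
  filter_upwards [h] with ω hω
  refine (hω.comp (tendsto_add_atTop_nat 1)).congr fun n => ?_
  simp [Finset.sum_range]

theorem integrable_circCF [IsProbabilityMeasure μ]
    (hident : ∀ j, IdentDistrib (X j) (X 0) μ μ) {T : ℝ → ℝ}
    (hT : Measurable T) (s : ℝ) (N : ℕ) [NeZero N] :
    Integrable (fun ω => circCF s N fun j => T (X j ω)) μ :=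
  Integrable.of_bound ((measurable_circCF s N).comp_aemeasurable
    (aemeasurable_pi_iff.2 fun j =>
      hT.comp_aemeasurable (hident j).aemeasurable_fst)).aestronglyMeasurable 1
    (ae_of_all _ fun _ => norm_circCF_le s N _)

theorem ae_tendsto_circCF_sub_integral_of_bounded [IsProbabilityMeasure μ] (hindep : iIndepFun X μ)
    (hident : ∀ j, IdentDistrib (X j) (X 0) μ μ) {T : ℝ → ℝ} (hT : Measurable T) {D : ℝ}
    (hTD : ∀ a, |T a| ≤ D) (s : ℝ) :
    ∀ᵐ ω ∂μ, Tendsto (fun n : ℕ => circCF s (n + 1) (fun j => T (X j ω))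
        - ∫ ω', circCF s (n + 1) (fun j => T (X j ω')) ∂μ) atTop (𝓝 0) := by
  filter_upwards [ae_tendsto_circStat_sub_integral hindep hident hT hTD hasQuadraticTaylor_cos s,
    ae_tendsto_circStat_sub_integral hindep hident hT hTD hasQuadraticTaylor_sin s] with ω h1 h2
  have h3 := ((Complex.continuous_ofReal.tendsto 0).comp h1).add
    (((Complex.continuous_ofReal.tendsto 0).comp h2).mul_const Complex.I)
  simp only [Complex.ofReal_zero, zero_mul, add_zero] at h3
  refine h3.congr fun n => ?_
  have hint : ∀ {ψ u : ℝ → ℝ}, HasQuadraticTaylor ψ u →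
      Integrable (fun ω' => (circStat ψ s (n + 1) (fun j => T (X j ω')) : ℂ)) μ := fun h =>
    (Integrable.of_bound ((measurable_circStat h.measurable s).comp_aemeasurable
      (aemeasurable_pi_iff.2 fun j =>
        hT.comp_aemeasurable (hident j).aemeasurable_fst)).aestronglyMeasurable 1
      (ae_of_all _ fun _ => abs_circStat_le h.abs_le s _)).ofReal
  simp only [circCF_eq, Function.comp_apply, Complex.ofReal_sub]
  rw [integral_add (hint hasQuadraticTaylor_cos) ((hint hasQuadraticTaylor_sin).mul_const _),
    integral_mul_const, integral_complex_ofReal, integral_complex_ofReal]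
  ring

theorem norm_integral_circCF_sub_integral_circCF_le [IsProbabilityMeasure μ]
    (hident : ∀ j, IdentDistrib (X j) (X 0) μ μ) {T : ℝ → ℝ} (hT : Measurable T)
    (hint : Integrable (fun ω => (X 0 ω - T (X 0 ω)) ^ 2) μ) (s : ℝ) (N : ℕ) [NeZero N]
    {δ : ℝ} (hδ : 0 < δ) :
    ‖∫ ω, circCF s N (fun j => X j ω) ∂μ - ∫ ω, circCF s N (fun j => T (X j ω)) ∂μ‖
      ≤ |s| * (δ + 2 / δ * ∫ ω, (X 0 ω - T (X 0 ω)) ^ 2 ∂μ) := by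
  have hN : (N : ℝ) ≠ 0 := Nat.cast_ne_zero.2 (NeZero.ne N)
  have hφ : Measurable fun a : ℝ => (a - T a) ^ 2 := (measurable_id.sub hT).pow_const 2
  have hid : ∀ j, IdentDistrib (fun ω => (X j ω - T (X j ω)) ^ 2)
      (fun ω => (X 0 ω - T (X 0 ω)) ^ 2) μ μ := fun j => (hident j).comp hφ
  have hintj : ∀ j, Integrable (fun ω => (X j ω - T (X j ω)) ^ 2) μ := fun j =>
    (hid j).integrable_iff.2 hint
  have hsum : Integrable (fun ω => ∑ j : Fin N, (X j ω - T (X j ω)) ^ 2) μ :=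
    integrable_finsetSum _ fun j _ => hintj j
  have hX := integrable_circCF hident measurable_id s N
  simp only [id] at hX
  rw [← integral_sub hX (integrable_circCF hident hT s N)]
  calc _ ≤ ∫ ω, |s| * (δ + 2 / δ * ((∑ j : Fin N, (X j ω - T (X j ω)) ^ 2) / N)) ∂μ :=
        norm_integral_le_of_norm_le
          (((integrable_const _).add ((hsum.div_const _).const_mul _)).const_mul _)
          (ae_of_all _ fun ω => norm_circCF_sub_circCF_le s _ _ hδ)
    _ = _ := by
        rw [integral_const_mul, integral_add (integrable_const _) ((hsum.div_const _).const_mul _),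
          integral_const_mul, integral_div, integral_finsetSum _ fun (j : Fin N) _ => hintj j]
        simp only [(hid _).integral_eq]
        simp [hN]

/-- Concentration of the empirical characteristic function for square integrable inputs. -/
theorem ae_tendsto_circCF_sub_integral [IsProbabilityMeasure μ] (hindep : iIndepFun X μ)
    (hident : ∀ j, IdentDistrib (X j) (X 0) μ μ) (hX2 : Integrable (fun ω => X 0 ω ^ 2) μ)
    (s : ℝ) :
    ∀ᵐ ω ∂μ, Tendsto (fun n : ℕ => circCF s (n + 1) (fun j => X j ω)
        - ∫ ω', circCF s (n + 1) (fun j => X j ω') ∂μ) atTop (𝓝 0) := by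
  have hX0 := (hident 0).aemeasurable_fst
  have hφ : ∀ m, Measurable fun a : ℝ => (a - clip m a) ^ 2 := fun m =>
    (measurable_id.sub (measurable_clip m)).pow_const 2
  have hint : ∀ m, Integrable (fun ω => (X 0 ω - clip m (X 0 ω)) ^ 2) μ := fun m =>
    hX2.mono' ((hφ m).comp_aemeasurable hX0).aestronglyMeasurable (ae_of_all _ fun ω => by
      rw [Real.norm_eq_abs, abs_of_nonneg (sq_nonneg _)]
      exact sq_sub_clip_le m _)
  -- Integer truncation levels keep the null sets countable, so the level may be chosen afterwards,
  -- depending on `ε`.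
  filter_upwards [ae_all_iff.2 fun m => ae_tendsto_circCF_sub_integral_of_bounded hindep hident
      (measurable_clip m) (abs_clip_le m) s,
    ae_all_iff.2 fun m => ae_tendsto_average hindep hident (hφ m) (hint m)] with ω h1 h2
  rw [Metric.tendsto_atTop']
  intro ε hε
  set δ := ε / (8 * (|s| + 1))
  have hs : 0 ≤ |s| := abs_nonneg s
  have hδ : 0 < δ := by positivity
  have hδε : 8 * δ * (|s| + 1) = ε := by
    simp only [δ]
    field_simp
  obtain ⟨m, hm⟩ := ((tendsto_integral_sq_sub_clip hX0 hX2).eventually_lt_const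
    (sq_pos_of_pos hδ)).exists
  have h3 := (h2 m).eventually_lt_const hm
  have h4 := Metric.tendsto_atTop'.1 (h1 m) (ε / 4) (by positivity)
  obtain ⟨n₁, hn₁⟩ := h4
  obtain ⟨n₂, hn₂⟩ := eventually_atTop.1 h3
  refine ⟨max n₁ n₂, fun n hn => ?_⟩
  have h5 := hn₁ n ((le_max_left _ _).trans_lt hn)
  have h6 := hn₂ n ((le_max_right _ _).trans hn.le)
  -- Used for the sample and for its expectation: together `6 * |s| * δ`, less than `3 * ε / 4`. The
  -- truncated deviation takes the remaining `ε / 4`.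
  have hbound : ∀ {v : ℝ}, v < δ ^ 2 → |s| * (δ + 2 / δ * v) ≤ 3 * (|s| * δ) := by
    intro v hv
    have h7 : 2 / δ * v ≤ 2 / δ * δ ^ 2 := by gcongr
    have h8 : 2 / δ * δ ^ 2 = 2 * δ := by field_simp
    have h9 : |s| * (δ + 2 / δ * v) ≤ |s| * (δ + 2 * δ) :=
      mul_le_mul_of_nonneg_left (by linarith) hs
    linarith
  have h7 := (norm_circCF_sub_circCF_le s (fun j : Fin (n + 1) => X j ω)
    (fun j => clip m (X j ω)) hδ).trans (hbound h6)
  have h8 := (norm_integral_circCF_sub_integral_circCF_le hident (measurable_clip m) (hint m) s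
    (n + 1) hδ).trans (hbound hm)
  rw [dist_zero_right] at h5 ⊢
  set A := circCF s (n + 1) (fun j => X j ω)
  set A' := circCF s (n + 1) (fun j => clip m (X j ω))
  set E := ∫ ω', circCF s (n + 1) (fun j => X j ω') ∂μ
  set E' := ∫ ω', circCF s (n + 1) (fun j => clip m (X j ω')) ∂μ
  have h9 : ‖A - E‖ ≤ ‖A - A'‖ + ‖A' - E'‖ + ‖E - E'‖ := by
    rw [norm_sub_rev E E', show A - E = (A - A') + (A' - E') + (E' - E) by ring]
    exact norm_add₃_le
  nlinarith

/-! ### All arguments simultaneously, and the conclusion -/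

theorem ae_forall_tendsto_circCF [IsProbabilityMeasure μ] (hindep : iIndepFun X μ)
    (hident : ∀ j, IdentDistrib (X j) (X 0) μ μ) (h0 : ∫ ω, X 0 ω ∂μ = 0)
    (h1 : ∫ ω, X 0 ω ^ 2 ∂μ = 1) :
    ∀ᵐ ω ∂μ, ∀ t : ℝ, Tendsto (fun n : ℕ => circCF t (n + 1) (fun j => X j ω)) atTop
      (𝓝 (Complex.exp (-(t ^ 2 / 2) : ℝ))) := by
  -- A non-integrable function has integral 0 by convention, so the value 1 forces integrability.
  have hX2 : Integrable (fun ω => X 0 ω ^ 2) μ := .of_integral_ne_zero (by simp [h1])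
  filter_upwards [ae_all_iff.2 fun q : ℚ => ae_tendsto_circCF_sub_integral hindep hident hX2 q,
    ae_tendsto_average hindep hident (measurable_id.pow_const 2) hX2] with ω hq havg t
  have hrat : ∀ q : ℚ, Tendsto (fun n : ℕ => circCF q (n + 1) (fun j => X j ω)) atTop
      (𝓝 (Complex.exp (-((q : ℝ) ^ 2 / 2) : ℝ))) := by
    intro q
    have := (hq q).add (tendsto_integral_circCF hindep hident h0 h1 q)
    simpa using this
  simp only [id] at havg
  rw [h1] at havg
  have hev : ∀ᶠ n : ℕ in atTop, (∑ j : Fin (n + 1), X j ω ^ 2) / ((n + 1 : ℕ) : ℝ) < 2 :=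
    havg.eventually_lt_const (by norm_num)
  rw [Metric.tendsto_atTop']
  intro ε hε
  have hcont : Continuous fun r : ℝ => Complex.exp (-(r ^ 2 / 2) : ℝ) := by fun_prop
  obtain ⟨r, hr, hball⟩ := Metric.continuous_iff.1 hcont t (ε / 3) (by positivity)
  -- Once the mean square is below 2, the Lipschitz constant is at most 1 + 2 · 2 = 5, and 5 · ε /
  -- 15 = ε / 3.
  obtain ⟨q, hq1, hq2⟩ := exists_rat_btwn (show t < t + min r (ε / 15) by
    have : 0 < min r (ε / 15) := lt_min hr (by positivity)
    linarith)
  have hqt : |(q : ℝ) - t| < min r (ε / 15) := by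
    rw [abs_of_pos (by linarith)]
    linarith
  have hb := hball q (by rw [Real.dist_eq]; exact hqt.trans_le (min_le_left _ _))
  obtain ⟨n₁, hn₁⟩ := Metric.tendsto_atTop'.1 (hrat q) (ε / 3) (by positivity)
  obtain ⟨n₂, hn₂⟩ := eventually_atTop.1 hev
  refine ⟨max n₁ n₂, fun n hn => ?_⟩
  have h5 := hn₁ n ((le_max_left _ _).trans_lt hn)
  have h6 := hn₂ n ((le_max_right _ _).trans hn.le)
  have h7 := norm_circCF_sub_circCF_le' (N := n + 1) t q (fun j => X j ω)
  have h8 : |t - q| * (1 + 2 * ((∑ j : Fin (n + 1), X j ω ^ 2) / ((n + 1 : ℕ) : ℝ))) ≤ ε / 3 := by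
    have h9 : |t - q| ≤ ε / 15 := by
      rw [abs_sub_comm]
      exact hqt.le.trans (min_le_right _ _)
    calc _ ≤ ε / 15 * (1 + 2 * 2) := by gcongr
      _ = ε / 3 := by ring
  have h10 := dist_triangle4 (circCF t (n + 1) fun j => X j ω) (circCF q (n + 1) fun j => X j ω)
    (Complex.exp (-((q : ℝ) ^ 2 / 2) : ℝ)) (Complex.exp (-(t ^ 2 / 2) : ℝ))
  rw [← dist_eq_norm] at h7
  linarith

end Iid

theorem charFun_esd {n : ℕ} [NeZero n] {A : Matrix (Fin n) (Fin n) ℝ} (hA : A.IsHermitian)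
    (t : ℝ) :
    charFun (esd A hA : Measure ℝ) t
      = (n : ℂ)⁻¹ * ∑ i, Complex.exp (t * hA.eigenvalues i * Complex.I) := by
  rw [charFun_apply_real]
  simp only [esd, ProbabilityMeasure.coe_mk]
  rw [integral_smul_measure, integral_finsetSum_measure]
  · simp [Complex.real_smul]
  · intro i _
    exact integrable_dirac (by simp)

theorem charFun_esd_symCirculant (n : ℕ) (x : ℕ → ℝ) (t : ℝ) :
    charFun (esd (symCirculant (n + 1) fun j => x j / √((n + 1 : ℕ) : ℝ))
      (symCirculant_isHermitian _ _) : Measure ℝ) t = circCF t (n + 1) fun j => x j := by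
  rw [charFun_esd, sum_eigenvalues_symCirculant n _
    (fun a => Complex.exp (t * a * Complex.I)), circCF]
  simp only [circEig_div]
  push_cast
  rfl

end

theorem theorem2 {Ω : Type*} [MeasurableSpace Ω] (μ : Measure Ω) [IsProbabilityMeasure μ]
    (X : ℕ → Ω → ℝ)
    (hindep : iIndepFun X μ)
    (hident : ∀ j, IdentDistrib (X j) (X 0) μ μ)
    (hmean : ∫ ω, X 0 ω ∂μ = 0)
    (hvar : variance (X 0) μ = 1) :
    ∀ᵐ ω ∂μ,
      Tendsto
        (fun n : ℕ =>
          esd (symCirculant (n + 1) (fun j => X j ω / Real.sqrt ((n + 1 : ℕ) : ℝ)))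
            (symCirculant_isHermitian _ _))
        atTop (𝓝 stdGaussianLaw) := by
  have h1 : ∫ ω, X 0 ω ^ 2 ∂μ = 1 := by
    rw [← variance_of_integral_eq_zero (hident 0).aemeasurable_fst hmean, hvar]
  filter_upwards [ae_forall_tendsto_circCF hindep hident hmean h1] with ω hω
  rw [ProbabilityMeasure.tendsto_iff_tendsto_charFun]
  intro t
  have hG : charFun (stdGaussianLaw : Measure ℝ) t = Complex.exp (-(t ^ 2 / 2) : ℝ) := by
    simp only [stdGaussianLaw, ProbabilityMeasure.coe_mk]
    rw [charFun_gaussianReal]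
    push_cast
    simp
  rw [hG]
  exact (hω t).congr fun n => (charFun_esd_symCirculant n (fun j => X j ω) t).symm
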